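/- Let $(\mathcal X,\mathcal B)$ and $(\Theta,\mathcal C)$ be Polish spaces with their Borel $\sigma$-algebras, let $P(dx\mid\theta)$ be a Markov kernel from $\Theta$ to $\mathcal X$, and let $\nu$ be a $\sigma$-finite measure on $\Theta$ such that the marginal measure $M(B)=\int_\Theta P(B\mid\theta)\,\nu(d\theta)$ is $\sigma$-finite. Definitions. A formal posterior for $(P,\nu)$ is a Markov kernel $Q(d\theta\mid x)$ from $\mathcal X$ to $\Theta$ such that $P(dx\mid\theta)\,\nu(d\theta)=Q(d\theta\mid x)\,M(dx)$ as measures on $\mathcal X\times\Theta$. The $P$-$\nu$ chain (for the choice $Q$) is the Markov chain $W=(W_0,W_1,\dots)$ on $\Theta$ with transition function $R(C\mid\theta)=\int_{\mathcal X}Q(C\mid x)\,P(dx\mid\theta)$; $P_{w}$ denotes its law on $\Theta^{\infty}$ when $W_0=w$. A measurable set $C\subseteq\Theta$ is $\nu$-proper if $0<\nu(C)<\infty$. The chain is locally-$\nu$-recurrent if, for every $\nu$-proper $C$, one has $P_{w}(W_n\in C\text{ for some }n\ge 1)=1$ for $\nu$-almost every $w\in C$. For a function $\phi:\Theta\to\mathbb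 R$ and a measurable $\delta:\mathcal X\to\mathbb R$, let $r_\phi(\delta,\theta)=\int_{\mathcal X}(\delta(x)-\phi(\theta))^2\,P(dx\mid\theta)\in[0,\infty]$. The formal posterior $Q$ (equivalently, the prior $\nu$) is strongly admissible if for every bounded measurable $\phi:\Theta\to\mathbb R$ the estimator $\hat\phi(x)=\int_\Theta\phi(\theta)\,Q(d\theta\mid x)$ is almost-$\nu$-admissible, that is: for every measurable $\delta:\mathcal X\to\mathbb R$ with $r_\phi(\delta,\theta)\le r_\phi(\hat\phi,\theta)$ for all $\theta\in\Theta$, the set $\{\theta: r_\phi(\delta,\theta)<r_\phi(\hat\phi,\theta)\}$ has $\nu$-measure zero. The same notions apply to any other model and prior. Let $t:\Theta\to[0,\infty)$ be measurable and put $s(A)=\nu(t^{-1}(A))$ for Borel $A\subseteq[0,\infty)$. Suppose there are pairwise disjoint Borel sets $A_1,A_2,\dots$ with $\bigcup_{i}A_i=[0,\infty)$ such that every $t^{-1}(A_i)$ is $\nu$-proper. Theorem 3.4. Under these assumptions: (a) There is a Markov kernel $\pi(d\theta\mid a)$ from $[0,\infty)$ to $\Theta$ such that $\nu(d\theta)=\pi(d\theta\mid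 a)\,s(da)$, meaning that $$\int_\Theta f_2(t(\theta))\,f_1(\theta)\,\nu(d\theta)=\int_0^\infty f_2(a)\Big(\int_\Theta f_1(\theta)\,\pi(d\theta\mid a)\Big)s(da)$$ for all measurable $f_1:\Theta\to[0,\infty]$ and $f_2:[0,\infty)\to[0,\infty]$. There is a formal posterior $Q$ for $(P,\nu)$. For every such $\pi$, with $\tilde P(dx\mid a)=\int_\Theta P(dx\mid\theta)\,\pi(d\theta\mid a)$, there is a formal posterior $\tilde Q(da\mid x)$ for $(\tilde P,s)$. (b) Let $\pi$, $Q$, $\tilde Q$ be any kernels as in (a). If the $\tilde P$-$s$ chain on $[0,\infty)$, whose transition function is $\tilde R(A\mid b)=\int_{\mathcal X}\tilde Q(A\mid x)\,\tilde P(dx\mid b)$, is locally-$s$-recurrent, then the $P$-$\nu$ chain is locally-$\nu$-recurrent. Hence $Q$ (equivalently, $\nu$) is strongly admissible. -/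

import Mathlib

open MeasureTheory ProbabilityTheory
open scoped NNReal ENNReal

namespace FormalBayes

/-- A `ν`-proper set: a measurable set `C` with `0 < ν C < ∞`. -/
def IsProper {Θ : Type*} [MeasurableSpace Θ] (ν : Measure Θ) (C : Set Θ) : Prop :=
  MeasurableSet C ∧ 0 < ν C ∧ ν C < ∞

/-- A sequence of pairwise disjoint Borel sets covering `[0, ∞)` whose preimages under `t` are
`ν`-proper. -/
def IsProperPartition {Θ : Type*} [MeasurableSpace Θ] (ν : Measure Θ) (t : Θ → ℝ≥0)
    (A : ℕ → Set ℝ≥0) : Prop :=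
  (∀ i, MeasurableSet (A i)) ∧ Pairwise (fun i j => Disjoint (A i) (A j)) ∧
    (⋃ i, A i) = Set.univ ∧ ∀ i, IsProper ν (t ⁻¹' A i)

/-- The disintegration `ν(dθ) = π(dθ | a) s(da)` of `ν` over `t`, where `s = ν.map t`. -/
def Disintegrates {Θ : Type*} [MeasurableSpace Θ] (ν : Measure Θ) (t : Θ → ℝ≥0)
    (π : Kernel ℝ≥0 Θ) : Prop :=
  ∀ (f₁ : Θ → ℝ≥0∞) (f₂ : ℝ≥0 → ℝ≥0∞), Measurable f₁ → Measurable f₂ →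
    ∫⁻ θ, f₂ (t θ) * f₁ θ ∂ν = ∫⁻ a, f₂ a * ∫⁻ θ, f₁ θ ∂(π a) ∂(ν.map t)

section Posterior

variable {Θ X : Type*} [MeasurableSpace Θ] [MeasurableSpace X]

/-- `Q(dθ | x)` is a formal posterior for the model `P` and the prior `ν`: with the marginal
measure `M(dx) = ∫ P(dx | θ) ν(dθ)`, that is `P ∘ₘ ν`, the joint measures `P(dx | θ) ν(dθ)` and
`Q(dθ | x) M(dx)` on `Θ × X` agree. -/
def IsFormalPosterior (P : Kernel Θ X) (ν : Measure Θ) (Q : Kernel X Θ) : Prop :=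
  ν ⊗ₘ P = ((P ∘ₘ ν) ⊗ₘ Q).map Prod.swap

/-- The formal Bayes estimator `x ↦ ∫ φ(θ) Q(dθ | x)`. -/
noncomputable def bayesEstimator (Q : Kernel X Θ) (φ : Θ → ℝ) (x : X) : ℝ :=
  ∫ θ, φ θ ∂(Q x)

/-- The risk function (under quadratic loss, with values in `[0, ∞]`) of the estimator `δ` of
`φ(θ)`. -/
noncomputable def risk (P : Kernel Θ X) (φ : Θ → ℝ) (δ : X → ℝ) (θ : Θ) : ℝ≥0∞ :=
  ∫⁻ x, ENNReal.ofReal ((δ x - φ θ) ^ 2) ∂(P θ)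

/-- `δ₀` is an almost-`ν`-admissible estimator of `φ(θ)`. -/
def IsAlmostAdmissible (P : Kernel Θ X) (ν : Measure Θ) (φ : Θ → ℝ) (δ₀ : X → ℝ) : Prop :=
  ∀ δ : X → ℝ, Measurable δ → (∀ θ, risk P φ δ θ ≤ risk P φ δ₀ θ) →
    ν {θ | risk P φ δ θ < risk P φ δ₀ θ} = 0

/-- The formal posterior `Q` for the model `P` and the prior `ν` is strongly admissible: for every
bounded measurable `φ`, the formal Bayes estimator of `φ(θ)` is almost-`ν`-admissible. -/
def IsStronglyAdmissible (P : Kernel Θ X) (ν : Measure Θ) (Q : Kernel X Θ) : Prop :=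
  ∀ φ : Θ → ℝ, Measurable φ → (∃ K : ℝ, ∀ θ, |φ θ| ≤ K) →
    IsAlmostAdmissible P ν φ (bayesEstimator Q φ)

end Posterior

section Chain

variable {Θ : Type*} [MeasurableSpace Θ]

/-- The transition function `R` as a kernel from histories `(w₀, …, wₙ)` to the next state. -/
noncomputable def historyKernel (R : Kernel Θ Θ) (n : ℕ) :
    Kernel (∀ _ : Finset.Iic n, Θ) Θ :=
  R.comap (fun w => w ⟨n, Finset.mem_Iic.2 le_rfl⟩) (measurable_pi_apply _)

instance (R : Kernel Θ Θ) [IsMarkovKernel R] (n : ℕ) : IsMarkovKernel (historyKernel R n) := by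
  unfold historyKernel
  infer_instance

/-- The law `P_{w₀}` on the path space of the Markov chain `W = (W₀, W₁, …)` with transition
function `R` and `W₀ = w₀`. -/
noncomputable def pathLaw (R : Kernel Θ Θ) [IsMarkovKernel R] (w₀ : Θ) : Measure (ℕ → Θ) :=
  Kernel.traj (X := fun _ => Θ) (historyKernel R) 0 (fun _ => w₀)

/-- The first time `n ≥ 1` at which the path is in `C` (`⊤` if there is none). -/
noncomputable def returnTime (C : Set Θ) (w : ℕ → Θ) : ℕ∞ :=
  ⨅ (n : ℕ) (_ : 1 ≤ n ∧ w n ∈ C), (n : ℕ∞)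

/-- The event `E_C` that the return time to `C` is finite. -/
def returnEvent (C : Set Θ) : Set (ℕ → Θ) := {w | returnTime C w < ⊤}

/-- The set `C` is locally-`ν`-recurrent for the chain with transition function `R`. -/
def IsLocallyRecurrentSet (R : Kernel Θ Θ) [IsMarkovKernel R] (ν : Measure Θ) (C : Set Θ) : Prop :=
  ν {w₀ | w₀ ∈ C ∧ pathLaw R w₀ (returnEvent C) < 1} = 0

/-- The Markov chain with transition function `R` is locally-`ν`-recurrent: every `ν`-proper set
is. -/
def IsLocallyRecurrent (R : Kernel Θ Θ) [IsMarkovKernel R] (ν : Measure Θ) : Prop :=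
  ∀ C : Set Θ, IsProper ν C → IsLocallyRecurrentSet R ν C

end Chain

/-- The transition function `R(C | θ) = ∫ Q(C | x) P(dx | θ)` of the chain attached to the model
`P` and the formal posterior `Q`. -/
noncomputable def transition {Θ X : Type*} [MeasurableSpace Θ] [MeasurableSpace X]
    (P : Kernel Θ X) (Q : Kernel X Θ) : Kernel Θ Θ :=
  Q ∘ₖ P

instance {Θ X : Type*} [MeasurableSpace Θ] [MeasurableSpace X] (P : Kernel Θ X) (Q : Kernel X Θ)
    [IsMarkovKernel P] [IsMarkovKernel Q] : IsMarkovKernel (transition P Q) := by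
  unfold transition
  infer_instance

/-- The reduced model `P̃(dx | a) = ∫ P(dx | θ) π(dθ | a)`. -/
noncomputable def reducedModel {Θ X : Type*} [MeasurableSpace Θ] [MeasurableSpace X]
    (P : Kernel Θ X) (π : Kernel ℝ≥0 Θ) : Kernel ℝ≥0 X :=
  P ∘ₖ π

instance {Θ X : Type*} [MeasurableSpace Θ] [MeasurableSpace X] (P : Kernel Θ X) (π : Kernel ℝ≥0 Θ)
    [IsMarkovKernel P] [IsMarkovKernel π] : IsMarkovKernel (reducedModel P π) := by
  unfold reducedModel
  infer_instance

end FormalBayes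

open FormalBayes

/-! Local recurrence is a statement about energy. By Bayes' identity the chain with kernel
`transition P Q` is reversible with respect to `ν`, and its Dirichlet form is `E(f, f) = ∫ f² dν - ∫
(Q f)² dM`, the `M`-mean of the posterior variance of `f`. For `C` of finite measure, local
recurrence is equivalent to the existence of integrable functions with values in `[0, 1]`, equal to
`1` on `C`, of arbitrarily small energy. One direction (`IsFormalPosterior.hasSmallCutoffs`) uses
truncated hitting probabilities of `C`, whose energy is at most the mass escaping from `C`. The
other (`HasSmallCutoffs.isLocallyRecurrentSet`) pairs a cutoff with these functions and applies
Cauchy-Schwarz.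

Energy passes through the reduction without loss: for `M`-almost every `x` the image of `Q x` under
`t` acts like the reduced posterior, so `g ∘ t` has exactly the energy of `g`
(`HasSmallCutoffs.preimage`). The process `t(W)` need not be Markov, and the two chains are never
compared pathwise. Recurrence of the reduced chain thus gives small cutoffs on each `t⁻¹(A i)`, and
these sets cover `Θ`, which yields recurrence of the full chain.

Strong admissibility comes from the same cutoffs by Blyth's method: weighting the risks by `h²`, the
formal Bayes estimator of a function bounded by `K` loses at most `16 K² E(h, h)` to any competitor
(`lintegral_weighted_sq_le`). -/

namespace FormalBayes

/-! ### Path space: return probabilities through iterates of the killed kernel. -/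

section PathLaw

variable {Θ : Type*} [MeasurableSpace Θ] {R : Kernel Θ Θ} {C : Set Θ}

/-- The operator `f ↦ (w ↦ ∫_{Cᶜ} f dR(w))` of the chain killed on `C`. -/
noncomputable def killedOp (R : Kernel Θ Θ) (C : Set Θ) (f : Θ → ℝ≥0∞) (w : Θ) : ℝ≥0∞ :=
  ∫⁻ y, Cᶜ.indicator f y ∂(R w)

/-- The probability that the chain avoids `C` at the times `1, …, n`. -/
noncomputable def avoidProb (R : Kernel Θ Θ) (C : Set Θ) (n : ℕ) : Θ → ℝ≥0∞ :=
  (killedOp R C)^[n] (fun _ => 1)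

/-- The set of paths which avoid `C` at the times `1, …, n`. -/
def avoidSet (C : Set Θ) (n : ℕ) : Set (ℕ → Θ) := {w | ∀ k, 1 ≤ k → k ≤ n → w k ∉ C}

lemma measurable_killedOp (hC : MeasurableSet C) {f : Θ → ℝ≥0∞} (hf : Measurable f) :
    Measurable (killedOp R C f) :=
  (hf.indicator hC.compl).lintegral_kernel

lemma avoidProb_succ (n : ℕ) : avoidProb R C (n + 1) = killedOp R C (avoidProb R C n) := by
  rw [avoidProb, Function.iterate_succ_apply', avoidProb]

lemma compl_returnEvent {Θ : Type*} (C : Set Θ) : (returnEvent C)ᶜ = ⋂ n, avoidSet C n := by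
  ext w
  simp only [returnEvent, returnTime, Set.mem_compl_iff, Set.mem_ofPred_eq, iInf_lt_iff,
    ENat.natCast_lt_top, Set.mem_iInter, avoidSet]
  constructor
  · intro h n k h1 _ h3
    exact h ⟨k, ⟨h1, h3⟩, trivial⟩
  · rintro h ⟨k, ⟨h1, h3⟩, -⟩
    exact h k k h1 le_rfl h3

instance isProbabilityMeasure_pathLaw [IsMarkovKernel R] (x : Θ) :
    IsProbabilityMeasure (pathLaw R x) := by
  unfold pathLaw; infer_instance

lemma lintegral_pathLaw_zero [IsMarkovKernel R] (x : Θ) {f : Θ → ℝ≥0∞} (hf : Measurable f) :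
    ∫⁻ w, f (w 0) ∂(pathLaw R x) = f x := by
  have h := Kernel.traj_map_frestrictLe_apply (X := fun _ => Θ) (κ := historyKernel R) 0 0
    (fun _ => x)
  rw [Kernel.partialTraj_self, Kernel.id_apply] at h
  have h2 : ∫⁻ u, f (u ⟨0, by simp⟩) ∂((pathLaw R x).map (Preorder.frestrictLe 0)) = f x := by
    unfold pathLaw
    rw [h, lintegral_dirac' _ (by fun_prop)]
  rwa [lintegral_map (by fun_prop) (by fun_prop)] at h2

/-- The Markov property at time `n`: the law of the path up to `n + 1` is the law up to `n` composed
with `historyKernel R n`, which sees only the last coordinate. -/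
lemma lintegral_pathLaw_step [IsMarkovKernel R] (x : Θ) (n : ℕ) {F : (Finset.Iic n → Θ) → ℝ≥0∞}
    (hF : Measurable F)
    {f : Θ → ℝ≥0∞} (hf : Measurable f) :
    ∫⁻ w, F (Preorder.frestrictLe n w) * f (w (n + 1)) ∂(pathLaw R x) =
      ∫⁻ w, F (Preorder.frestrictLe n w) * ∫⁻ y, f y ∂(R (w n)) ∂(pathLaw R x) := by
  have h := Kernel.partialTraj_compProd_eq_map_traj (X := fun _ => Θ) (κ := historyKernel R)
    (Nat.zero_le n) (x₀ := fun _ => x)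
  have h1 := Kernel.traj_map_frestrictLe_apply (X := fun _ => Θ) (κ := historyKernel R) 0 n
    (fun _ => x)
  rw [← h1] at h
  have hm : Measurable fun p : (Finset.Iic n → Θ) × Θ => F p.1 * f p.2 := by fun_prop
  have hm' : Measurable fun u : Finset.Iic n → Θ =>
      F u * ∫⁻ y, f y ∂(historyKernel R n u) := hF.mul hf.lintegral_kernel
  have h2 := congrArg (fun μ => ∫⁻ p, F p.1 * f p.2 ∂μ) h
  simp only at h2
  rw [lintegral_map hm (by fun_prop), Measure.lintegral_compProd hm] at h2
  simp_rw [lintegral_const_mul _ hf] at h2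
  rw [lintegral_map hm' (by fun_prop)] at h2
  exact h2.symm

lemma measurableSet_avoidSet (hC : MeasurableSet C) (n : ℕ) : MeasurableSet (avoidSet C n) := by
  have : avoidSet C n = ⋂ k, ⋂ (_ : 1 ≤ k), ⋂ (_ : k ≤ n), (fun w : ℕ → Θ => w k) ⁻¹' Cᶜ := by
    ext w; simp [avoidSet]
  rw [this]
  exact .iInter fun k => .iInter fun _ => .iInter fun _ => measurable_pi_apply k hC.compl

/-- The Markov property removes the last step, turning `f` at time `n + 1` into `killedOp R C f` at
time `n`; the induction therefore needs arbitrary `f`, although only `f = 1` is used afterwards. -/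
lemma lintegral_avoidSet [IsMarkovKernel R] (hC : MeasurableSet C) (x : Θ) (n : ℕ) {f : Θ → ℝ≥0∞}
    (hf : Measurable f) :
    ∫⁻ w, (avoidSet C n).indicator (fun w => f (w n)) w ∂(pathLaw R x) =
      (killedOp R C)^[n] f x := by
  induction n generalizing f with
  | zero =>
    have : avoidSet C 0 = Set.univ := by
      ext w; simp only [avoidSet, Set.mem_ofPred_eq, Set.mem_univ, iff_true]; omega
    simp [this, lintegral_pathLaw_zero x hf]
  | succ n ih =>
    rw [Function.iterate_succ_apply, ← ih (measurable_killedOp hC hf)]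
    let S : Set (Finset.Iic n → Θ) := {u | ∀ k (hk : k ≤ n), 1 ≤ k → u ⟨k, Finset.mem_Iic.2 hk⟩ ∉ C}
    have hS : MeasurableSet S := by
      have : S = ⋂ k, ⋂ (hk : k ≤ n), ⋂ (_ : 1 ≤ k),
          (fun u : Finset.Iic n → Θ => u ⟨k, Finset.mem_Iic.2 hk⟩) ⁻¹' Cᶜ := by
        ext w; simp [S]
      rw [this]
      exact .iInter fun k => .iInter fun _ => .iInter fun _ => measurable_pi_apply _ hC.compl
    have key := lintegral_pathLaw_step (R := R) x n (F := S.indicator 1)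
      (measurable_one.indicator hS) (hf.indicator hC.compl)
    have hmem : ∀ w : ℕ → Θ, Preorder.frestrictLe n w ∈ S ↔ w ∈ avoidSet C n := fun w =>
      ⟨fun h k h1 h2 => h k h2 h1, fun h k h1 h2 => h k h2 h1⟩
    have hmem' : ∀ w : ℕ → Θ, w ∈ avoidSet C (n + 1) ↔ w ∈ avoidSet C n ∧ w (n + 1) ∉ C := by
      refine fun w => ⟨fun h => ⟨fun k h1 h2 => h k h1 (by omega), h _ (by omega) le_rfl⟩, ?_⟩
      rintro ⟨h, h'⟩ k h1 h2
      rcases Nat.lt_or_ge n k with h3 | h3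
      · obtain rfl : k = n + 1 := by omega
        exact h'
      · exact h k h1 h3
    refine Eq.trans (lintegral_congr fun w => ?_) (key.trans (lintegral_congr fun w => ?_))
    · by_cases h1 : w ∈ avoidSet C n <;> by_cases h2 : w (n + 1) ∈ C <;>
        simp [Set.indicator, hmem, hmem', h1, h2]
    · by_cases h1 : w ∈ avoidSet C n <;> simp [Set.indicator, hmem, h1, killedOp]

lemma pathLaw_avoidSet [IsMarkovKernel R] (hC : MeasurableSet C) (x : Θ) (n : ℕ) :
    pathLaw R x (avoidSet C n) = avoidProb R C n x := by
  rw [avoidProb, ← lintegral_avoidSet hC x n measurable_const,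
    lintegral_indicator (measurableSet_avoidSet hC n)]
  simp

lemma pathLaw_compl_returnEvent [IsMarkovKernel R] (hC : MeasurableSet C) (x : Θ) :
    pathLaw R x (returnEvent C)ᶜ = ⨅ n, avoidProb R C n x := by
  rw [compl_returnEvent, Antitone.measure_iInter _
    (fun n => (measurableSet_avoidSet hC n).nullMeasurableSet) ⟨0, measure_ne_top _ _⟩]
  · simp_rw [pathLaw_avoidSet hC]
  · exact fun m n hmn w h k h1 h2 => h k h1 (h2.trans hmn)

lemma pathLaw_returnEvent_lt_one_iff [IsMarkovKernel R] (hC : MeasurableSet C) (x : Θ) :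
    pathLaw R x (returnEvent C) < 1 ↔ ⨅ n, avoidProb R C n x ≠ 0 := by
  have hm : MeasurableSet (returnEvent C) := by
    rw [← MeasurableSet.compl_iff, compl_returnEvent]
    exact .iInter fun n => measurableSet_avoidSet hC n
  rw [← pathLaw_compl_returnEvent hC, Ne, prob_compl_eq_zero_iff hm,
    lt_iff_le_and_ne, and_iff_right prob_le_one]

end PathLaw

/-! ### Potential theory: the hitting probability of a set and its truncations. -/

section Potential

variable {Θ : Type*} [MeasurableSpace Θ] {R : Kernel Θ Θ} {C : Set Θ} {D : ℕ → Set Θ}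

open Classical in
/-- Approximations of the probability of hitting `C`: the `(n+1)`-st approximation is `1` on `C`
and the average of the `n`-th over `R` on `D n \ C`. -/
noncomputable def potential (R : Kernel Θ Θ) (C : Set Θ) (D : ℕ → Set Θ) : ℕ → Θ → ℝ≥0∞
  | 0 => C.indicator 1
  | n + 1 => fun w => if w ∈ C then 1 else if w ∈ D n then ∫⁻ y, potential R C D n y ∂(R w) else 0

lemma potential_of_mem {w : Θ} (hw : w ∈ C) (n : ℕ) : potential R C D n w = 1 := by
  cases n <;> simp [potential, hw]

lemma potential_zero_of_notMem {w : Θ} (hw : w ∉ C) : potential R C D 0 w = 0 := by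
  simp [potential, hw]

lemma potential_succ_of_mem {w : Θ} (hw : w ∉ C) {n : ℕ} (hD : w ∈ D n) :
    potential R C D (n + 1) w = ∫⁻ y, potential R C D n y ∂(R w) := by
  simp [potential, hw, hD]

lemma potential_succ_of_notMem {w : Θ} (hw : w ∉ C) {n : ℕ} (hD : w ∉ D n) :
    potential R C D (n + 1) w = 0 := by
  simp [potential, hw, hD]

lemma measurable_potential (hC : MeasurableSet C) (hD : ∀ n, MeasurableSet (D n)) (n : ℕ) :
    Measurable (potential R C D n) := by
  induction n with
  | zero => exact measurable_one.indicator hC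
  | succ n ih =>
    exact Measurable.ite hC measurable_const
      (Measurable.ite (hD n) ih.lintegral_kernel measurable_const)

lemma potential_le_one [IsMarkovKernel R] (n : ℕ) (w : Θ) : potential R C D n w ≤ 1 := by
  induction n generalizing w with
  | zero => exact Set.indicator_le_self' (by simp) w
  | succ n ih =>
    by_cases hw : w ∈ C
    · exact (potential_of_mem hw _).le
    by_cases hD : w ∈ D n
    · rw [potential_succ_of_mem hw hD]
      exact (lintegral_mono ih).trans (by simp)
    · simp [potential_succ_of_notMem hw hD]

lemma potential_le_succ (hD : Monotone D) (n : ℕ) (w : Θ) :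
    potential R C D n w ≤ potential R C D (n + 1) w := by
  induction n generalizing w with
  | zero =>
    by_cases hw : w ∈ C
    · simp [potential_of_mem hw]
    · simp [potential_zero_of_notMem hw]
  | succ n ih =>
    by_cases hw : w ∈ C
    · simp [potential_of_mem hw]
    by_cases h : w ∈ D n
    · rw [potential_succ_of_mem hw h, potential_succ_of_mem hw (hD n.le_succ h)]
      exact lintegral_mono ih
    · simp [potential_succ_of_notMem hw h]

lemma monotone_potential (hD : Monotone D) : Monotone (potential R C D) :=
  monotone_nat_of_le_succ fun n w => potential_le_succ hD n w

/-- Subharmonicity off `C`: replacing the average by `0` outside `D n` only lowers the function, and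
the approximations increase with `n`. This sign controls the energy of the truncations. -/
lemma potential_le_lintegral (hD : Monotone D) {w : Θ} (hw : w ∉ C) (n : ℕ) :
    potential R C D n w ≤ ∫⁻ y, potential R C D n y ∂(R w) := by
  cases n with
  | zero => simp [potential_zero_of_notMem hw]
  | succ n =>
    by_cases h : w ∈ D n
    · rw [potential_succ_of_mem hw h]
      exact lintegral_mono (potential_le_succ hD n)
    · simp [potential_succ_of_notMem hw h]

lemma potential_eq_zero {w : Θ} (hw : w ∉ C) (hD : Monotone D) {n : ℕ} (h : w ∉ D n) :
    potential R C D n w = 0 := by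
  cases n with
  | zero => exact potential_zero_of_notMem hw
  | succ n => exact potential_succ_of_notMem hw fun h' => h (hD n.le_succ h')

/-- The limit of `potential`: the probability of hitting `C`. -/
noncomputable def limitPotential (R : Kernel Θ Θ) (C : Set Θ) (D : ℕ → Set Θ) (w : Θ) : ℝ≥0∞ :=
  ⨆ n, potential R C D n w

lemma limitPotential_of_mem {w : Θ} (hw : w ∈ C) : limitPotential R C D w = 1 := by
  simp [limitPotential, potential_of_mem hw]

lemma measurable_limitPotential (hC : MeasurableSet C) (hD : ∀ n, MeasurableSet (D n)) :
    Measurable (limitPotential R C D) :=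
  .iSup fun n => measurable_potential hC hD n

lemma lintegral_limitPotential (hC : MeasurableSet C) (hDm : ∀ n, MeasurableSet (D n))
    (hD : Monotone D) (w : Θ) :
    ∫⁻ y, limitPotential R C D y ∂(R w) = ⨆ n, ∫⁻ y, potential R C D n y ∂(R w) :=
  lintegral_iSup (measurable_potential hC hDm) (monotone_potential hD)

/-- Harmonicity off `C`. One inequality is the limit of subharmonicity; for the other, `w` lies in
some `D N`, so the truncation is inactive at `w` from stage `N` on. -/
lemma limitPotential_of_notMem (hC : MeasurableSet C) (hDm : ∀ n, MeasurableSet (D n))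
    (hD : Monotone D) (hU : ⋃ n, D n = Set.univ) {w : Θ} (hw : w ∉ C) :
    limitPotential R C D w = ∫⁻ y, limitPotential R C D y ∂(R w) := by
  rw [lintegral_limitPotential hC hDm hD]
  apply le_antisymm
  · exact iSup_mono fun n => potential_le_lintegral hD hw n
  · obtain ⟨N, hN⟩ : ∃ N, w ∈ D N := by simpa using hU.symm.subset (Set.mem_univ w)
    refine iSup_le fun n => ?_
    refine le_trans ?_ (le_iSup (fun n => potential R C D n w) (max n N + 1))
    rw [potential_succ_of_mem hw (hD (le_max_right n N) hN)]
    exact lintegral_mono (monotone_potential hD (le_max_left n N))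

lemma one_le_lintegral_limitPotential_add [IsMarkovKernel R] (hC : MeasurableSet C)
    (hDm : ∀ n, MeasurableSet (D n)) (hD : Monotone D) (hU : ⋃ n, D n = Set.univ) (n : ℕ) (w : Θ) :
    1 ≤ ∫⁻ y, limitPotential R C D y ∂(R w) + avoidProb R C n w := by
  induction n generalizing w with
  | zero => simp [avoidProb]
  | succ n ih =>
    rw [avoidProb_succ, killedOp, ← lintegral_add_left (measurable_limitPotential hC hDm)]
    calc (1 : ℝ≥0∞) = ∫⁻ _, 1 ∂(R w) := by simp
      _ ≤ _ := by
        refine lintegral_mono fun y => ?_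
        by_cases hy : y ∈ C
        · simp [limitPotential_of_mem hy, hy]
        · simpa [limitPotential_of_notMem hC hDm hD hU hy, hy] using ih y

/-- Hitting `C` within the times `1, …, n + 1` and avoiding it throughout are disjoint events; the
truncation by `D` only loses hitting probability. Started off `C`, the approximation of index `n`
allows `n` steps, and the integral over `R w` adds one more. -/
lemma lintegral_potential_add_le_one [IsMarkovKernel R] (hC : MeasurableSet C)
    (hDm : ∀ n, MeasurableSet (D n)) (n : ℕ) (w : Θ) :
    ∫⁻ y, potential R C D n y ∂(R w) + avoidProb R C (n + 1) w ≤ 1 := by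
  have step : ∀ n, (∀ y ∉ C, potential R C D n y + avoidProb R C n y ≤ 1) → ∀ w,
      ∫⁻ y, potential R C D n y ∂(R w) + avoidProb R C (n + 1) w ≤ 1 := by
    intro n h w
    rw [avoidProb_succ, killedOp, ← lintegral_add_left (measurable_potential hC hDm n)]
    calc _ ≤ ∫⁻ _, 1 ∂(R w) := by
          refine lintegral_mono fun y => ?_
          by_cases hy : y ∈ C
          · simp [potential_of_mem hy, hy]
          · simpa [hy] using h y hy
      _ = 1 := by simp
  refine step n ?_ w
  clear w
  induction n with
  | zero => intro y hy; simp [potential_zero_of_notMem hy, avoidProb]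
  | succ n ih =>
    intro y hy
    refine le_trans ?_ (step n ih y)
    gcongr
    by_cases h : y ∈ D n
    · rw [potential_succ_of_mem hy h]
    · simp [potential_succ_of_notMem hy h]

/-- The limits of the two preceding bounds make the integral and the probability of never returning
add up to `1`. This replaces the path-space event by a one-step integral. -/
lemma pathLaw_returnEvent_lt_one_iff_lintegral [IsMarkovKernel R] (hC : MeasurableSet C)
    (hDm : ∀ n, MeasurableSet (D n)) (hD : Monotone D) (hU : ⋃ n, D n = Set.univ) (w : Θ) :
    pathLaw R w (returnEvent C) < 1 ↔ ∫⁻ y, limitPotential R C D y ∂(R w) < 1 := by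
  rw [pathLaw_returnEvent_lt_one_iff hC, ← not_iff_not, not_not, not_lt]
  constructor
  · intro h
    have : 1 ≤ ⨅ n, (∫⁻ y, limitPotential R C D y ∂(R w) + avoidProb R C n w) :=
      le_iInf fun n => one_le_lintegral_limitPotential_add hC hDm hD hU n w
    rwa [← ENNReal.add_iInf, h, add_zero] at this
  · intro h
    rw [lintegral_limitPotential hC hDm hD] at h
    set a := ⨅ n, avoidProb R C n w
    have ha : a ≤ 1 := iInf_le_of_le 0 (by simp [avoidProb])
    have : (⨆ n, ∫⁻ y, potential R C D n y ∂(R w)) + a ≤ 1 := by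
      rw [ENNReal.iSup_add]
      refine iSup_le fun n => le_trans ?_ (lintegral_potential_add_le_one (R := R) hC hDm n w)
      gcongr
      exact iInf_le _ _
    have h3 : 1 + a ≤ 1 + 0 := by simpa using (add_le_add h le_rfl).trans this
    simpa using (ENNReal.add_le_add_iff_left ENNReal.one_ne_top).1 h3

end Potential

lemma _root_.MeasureTheory.Integrable.integral_measure_compProd {α β : Type*} [MeasurableSpace α]
    [MeasurableSpace β] {μ : Measure α} [SFinite μ] {κ : Kernel α β} [IsSFiniteKernel κ]
    {f : α × β → ℝ} (hf : Integrable f (μ ⊗ₘ κ)) :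
    Integrable (fun x => ∫ y, f (x, y) ∂(κ x)) μ := by
  simpa using Integrable.integral_compProd (κ := Kernel.const Unit μ)
    (η := Kernel.prodMkLeft Unit κ) (a := ()) hf

lemma measurable_bayesEstimator {Θ X : Type*} [MeasurableSpace Θ] [MeasurableSpace X]
    {Q : Kernel X Θ} {f : Θ → ℝ} (hf : Measurable f) :
    Measurable (bayesEstimator Q f) :=
  (hf.stronglyMeasurable.integral_kernel).measurable

/-! ### The Dirichlet form attached to a model and its formal posterior. -/

section Energy

variable {Θ X : Type*} [MeasurableSpace Θ] [MeasurableSpace X] {P : Kernel Θ X} [IsMarkovKernel P]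
  {ν : Measure Θ} {Q : Kernel X Θ} [IsMarkovKernel Q]

lemma IsFormalPosterior.lintegral_swap [SFinite ν] (hQ : IsFormalPosterior P ν Q) {F : Θ × X → ℝ≥0∞}
    (hF : Measurable F) :
    ∫⁻ θ, ∫⁻ x, F (θ, x) ∂(P θ) ∂ν = ∫⁻ x, ∫⁻ θ, F (θ, x) ∂(Q x) ∂(P ∘ₘ ν) := by
  rw [← Measure.lintegral_compProd hF, hQ, lintegral_map hF measurable_swap,
    Measure.lintegral_compProd (by fun_prop)]
  simp

/-- The other marginal of the joint measure: `ν` is invariant for the chain. -/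
lemma IsFormalPosterior.comp_eq [SFinite ν] (hQ : IsFormalPosterior P ν Q) : Q ∘ₘ (P ∘ₘ ν) = ν := by
  ext s hs
  rw [Measure.bind_apply hs (by fun_prop)]
  have h := hQ.lintegral_swap (F := fun p => s.indicator 1 p.1)
    ((measurable_one.indicator hs).comp measurable_fst)
  simpa [lintegral_indicator_one hs] using h.symm

lemma IsFormalPosterior.integral_swap [SFinite ν] (hQ : IsFormalPosterior P ν Q) {F : Θ × X → ℝ}
    (hFi : Integrable F (ν ⊗ₘ P)) :
    ∫ θ, ∫ x, F (θ, x) ∂(P θ) ∂ν = ∫ x, ∫ θ, F (θ, x) ∂(Q x) ∂(P ∘ₘ ν) := by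
  have h := hFi
  rw [← Measure.integral_compProd hFi]
  rw [hQ] at h ⊢
  have hm := h.aestronglyMeasurable
  rw [integral_map measurable_swap.aemeasurable hm]
  rw [integrable_map_measure hm measurable_swap.aemeasurable] at h
  exact Measure.integral_compProd h

lemma _root_.MeasureTheory.Integrable.comp_fst_compProd [SFinite ν] {f : Θ → ℝ}
    (hf : Integrable f ν) :
    Integrable (fun p : Θ × X => f p.1) (ν ⊗ₘ P) := by
  have : Integrable f ((ν ⊗ₘ P).map Prod.fst) := by
    rwa [← Measure.fst, Measure.fst_compProd]
  exact this.comp_measurable measurable_fst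

lemma IsFormalPosterior.integral_eq [SFinite ν] (hQ : IsFormalPosterior P ν Q) {f : Θ → ℝ}
    (hf : Integrable f ν) : ∫ θ, f θ ∂ν = ∫ x, bayesEstimator Q f x ∂(P ∘ₘ ν) := by
  have h := hQ.integral_swap (hf.comp_fst_compProd (P := P))
  simpa [bayesEstimator] using h

lemma IsFormalPosterior.integrable_bayesEstimator [SFinite ν] (hQ : IsFormalPosterior P ν Q)
    {f : Θ → ℝ}
    (hf : Integrable f ν) : Integrable (bayesEstimator Q f) (P ∘ₘ ν) := by
  have h : Integrable (fun p : X × Θ => f p.2) ((P ∘ₘ ν) ⊗ₘ Q) := by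
    have : Integrable f (((P ∘ₘ ν) ⊗ₘ Q).map Prod.snd) := by
      rwa [← Measure.snd, Measure.snd_compProd, hQ.comp_eq]
    exact this.comp_measurable measurable_snd
  exact h.integral_measure_compProd

/-- Bounded measurable integrable functions. -/
structure IsTest (ν : Measure Θ) (f : Θ → ℝ) : Prop where
  measurable : Measurable f
  bounded : ∃ K, ∀ θ, |f θ| ≤ K
  integrable : Integrable f ν

lemma IsTest.integrable_mul {f g : Θ → ℝ} (hf : IsTest ν f) (hg : IsTest ν g) :
    Integrable (fun θ => f θ * g θ) ν := by
  obtain ⟨K, hK⟩ := hf.bounded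
  exact hg.integrable.bdd_mul hf.measurable.aestronglyMeasurable (.of_forall hK)

lemma IsTest.const_mul_sub {f g : Θ → ℝ} (hf : IsTest ν f) (hg : IsTest ν g) (c : ℝ) :
    IsTest ν (fun θ => c * f θ - g θ) := by
  obtain ⟨K, hK⟩ := hf.bounded
  obtain ⟨L, hL⟩ := hg.bounded
  refine ⟨(hf.measurable.const_mul c).sub hg.measurable, ⟨|c| * K + L, fun θ => ?_⟩,
    (hf.integrable.const_mul c).sub hg.integrable⟩
  calc |c * f θ - g θ| ≤ |c * f θ| + |g θ| := abs_sub _ _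
    _ ≤ |c| * K + L := by
      rw [abs_mul]; exact add_le_add (mul_le_mul_of_nonneg_left (hK θ) (abs_nonneg _)) (hL θ)

lemma integrable_of_abs_le {α : Type*} [MeasurableSpace α] {μ : Measure α} [IsFiniteMeasure μ]
    {f : α → ℝ} (hf : Measurable f) {K : ℝ} (hK : ∀ x, |f x| ≤ K) : Integrable f μ :=
  .of_bound hf.aestronglyMeasurable K (.of_forall hK)

lemma abs_integral_le_of_abs_le {α : Type*} [MeasurableSpace α] {μ : Measure α}
    [IsProbabilityMeasure μ] {f : α → ℝ} {K : ℝ} (hK : ∀ x, |f x| ≤ K) : |∫ x, f x ∂μ| ≤ K := by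
  have h := norm_integral_le_of_norm_le_const (μ := μ) (f := f) (C := K) (.of_forall hK)
  simpa using h

lemma IsFormalPosterior.isTest_bayesEstimator [SFinite ν] (hQ : IsFormalPosterior P ν Q) {f : Θ → ℝ}
    (hf : IsTest ν f) : IsTest (P ∘ₘ ν) (bayesEstimator Q f) := by
  obtain ⟨K, hK⟩ := hf.bounded
  exact ⟨measurable_bayesEstimator hf.measurable, ⟨K, fun x => abs_integral_le_of_abs_le hK⟩,
    hQ.integrable_bayesEstimator hf.integrable⟩

/-- The Dirichlet form of the chain attached to `P`, `ν` and `Q`. -/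
noncomputable def dirichletForm (P : Kernel Θ X) (ν : Measure Θ) (Q : Kernel X Θ) (f g : Θ → ℝ) :
    ℝ :=
  ∫ θ, f θ * g θ ∂ν - ∫ x, bayesEstimator Q f x * bayesEstimator Q g x ∂(P ∘ₘ ν)

lemma variance_kernel_eq {f : Θ → ℝ} (hm : Measurable f) {K : ℝ} (hK : ∀ θ, |f θ| ≤ K) (x : X) :
    Var[f; Q x] = bayesEstimator Q (fun θ => f θ * f θ) x -
      bayesEstimator Q f x * bayesEstimator Q f x := by
  rw [variance_eq_sub (MemLp.of_bound hm.aestronglyMeasurable K (.of_forall hK))]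
  simp [bayesEstimator, sq]

lemma IsFormalPosterior.integrable_variance [SFinite ν] (hQ : IsFormalPosterior P ν Q) {f : Θ → ℝ}
    (hf : IsTest ν f) : Integrable (fun x => Var[f; Q x]) (P ∘ₘ ν) := by
  obtain ⟨K, hK⟩ := hf.bounded
  simp_rw [variance_kernel_eq hf.measurable hK]
  have h := hQ.isTest_bayesEstimator hf
  exact (hQ.integrable_bayesEstimator (hf.integrable_mul hf)).sub (h.integrable_mul h)

/-- Disintegrating `∫ f² dν` over the posterior leaves the mean posterior variance. It gives
positivity of the form, and it is the shape in which the energy enters Blyth's estimate. -/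
lemma IsFormalPosterior.dirichletForm_self [SFinite ν] (hQ : IsFormalPosterior P ν Q) {f : Θ → ℝ}
    (hf : IsTest ν f) : dirichletForm P ν Q f f = ∫ x, Var[f; Q x] ∂(P ∘ₘ ν) := by
  obtain ⟨K, hK⟩ := hf.bounded
  simp_rw [variance_kernel_eq hf.measurable hK]
  have h := hQ.isTest_bayesEstimator hf
  rw [integral_sub (hQ.integrable_bayesEstimator (hf.integrable_mul hf)) (h.integrable_mul h),
    dirichletForm, hQ.integral_eq (hf.integrable_mul hf)]

lemma IsFormalPosterior.dirichletForm_self_nonneg [SFinite ν] (hQ : IsFormalPosterior P ν Q)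
    {f : Θ → ℝ}
    (hf : IsTest ν f) : 0 ≤ dirichletForm P ν Q f f := by
  rw [hQ.dirichletForm_self hf]
  exact integral_nonneg fun x => variance_nonneg _ _

lemma IsTest.integral_const_mul_sub_sq {f g : Θ → ℝ} (hf : IsTest ν f) (hg : IsTest ν g) (c : ℝ) :
    ∫ θ, (c * f θ - g θ) * (c * f θ - g θ) ∂ν =
      c ^ 2 * ∫ θ, f θ * f θ ∂ν - 2 * c * ∫ θ, f θ * g θ ∂ν + ∫ θ, g θ * g θ ∂ν := by
  have h1 := (hf.integrable_mul hf).const_mul (c ^ 2)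
  have h2 := (hf.integrable_mul hg).const_mul (2 * c)
  rw [← integral_const_mul, ← integral_const_mul, ← integral_sub h1 h2,
    ← integral_add (f := fun θ => c ^ 2 * (f θ * f θ) - 2 * c * (f θ * g θ)) (h1.sub h2)
      (hg.integrable_mul hg)]
  congr 1 with θ
  ring

/-- A form of the Cauchy-Schwarz inequality for the Dirichlet form. -/
lemma IsFormalPosterior.two_mul_dirichletForm_le [SFinite ν] (hQ : IsFormalPosterior P ν Q)
    {f g : Θ → ℝ}
    (hf : IsTest ν f) (hg : IsTest ν g) (c : ℝ) :
    2 * c * dirichletForm P ν Q f g ≤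
      c ^ 2 * dirichletForm P ν Q f f + dirichletForm P ν Q g g := by
  have h := hQ.dirichletForm_self_nonneg (hf.const_mul_sub hg c)
  have hlin : bayesEstimator Q (fun θ => c * f θ - g θ) =
      fun x => c * bayesEstimator Q f x - bayesEstimator Q g x := by
    obtain ⟨K, hK⟩ := hf.bounded
    obtain ⟨L, hL⟩ := hg.bounded
    funext x
    simp only [bayesEstimator]
    rw [integral_sub ((integrable_of_abs_le hf.measurable hK).const_mul c)
      (integrable_of_abs_le hg.measurable hL), integral_const_mul]
  rw [dirichletForm, hlin, hf.integral_const_mul_sub_sq hg,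
    (hQ.isTest_bayesEstimator hf).integral_const_mul_sub_sq (hQ.isTest_bayesEstimator hg)] at h
  simp only [dirichletForm]
  linarith

lemma bayesEstimator_transition {g : Θ → ℝ} (hm : Measurable g) {K : ℝ} (hK : ∀ θ, |g θ| ≤ K)
    (θ : Θ) : ∫ η, g η ∂(transition P Q θ) = ∫ x, bayesEstimator Q g x ∂(P θ) := by
  have h : Integrable g ((Q ∘ₖ P) θ) := integrable_of_abs_le hm hK
  exact Kernel.integral_comp h

/-- Green's formula: Bayes' identity moves one factor of the product of posterior means back to `Θ`.
The generator then falls on `g` alone, so harmonicity of `g` off `C` can be used. -/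
lemma IsFormalPosterior.dirichletForm_eq [SFinite ν] (hQ : IsFormalPosterior P ν Q) {f g : Θ → ℝ}
    (hf : IsTest ν f) (hg : IsTest ν g) :
    dirichletForm P ν Q f g = ∫ θ, f θ * (g θ - ∫ η, g η ∂(transition P Q θ)) ∂ν := by
  obtain ⟨L, hL⟩ := hg.bounded
  have hgb := hQ.isTest_bayesEstimator hg
  have hF : Integrable (fun p : Θ × X => f p.1 * bayesEstimator Q g p.2) (ν ⊗ₘ P) := by
    have := (hf.integrable.comp_fst_compProd (P := P)).bdd_mul
      (f := fun p : Θ × X => bayesEstimator Q g p.2) (c := L)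
      (hgb.measurable.comp measurable_snd).aestronglyMeasurable
      (.of_forall fun p => abs_integral_le_of_abs_le hL)
    simpa only [mul_comm] using this
  have h := hQ.integral_swap hF
  simp only [integral_const_mul, integral_mul_const] at h
  have hi : Integrable (fun θ => f θ * ∫ η, g η ∂(transition P Q θ)) ν := by
    simp_rw [bayesEstimator_transition hg.measurable hL]
    simpa only [integral_const_mul] using hF.integral_measure_compProd
  simp_rw [mul_sub]
  rw [integral_sub (hf.integrable_mul hg) hi, dirichletForm]
  simp_rw [bayesEstimator_transition hg.measurable hL, h]
  rfl

end Energy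

/-! ### Local recurrence is equivalent to cutoffs of arbitrarily small energy. -/

section Recurrence

open Filter Topology

/-- Integrable functions with values in `[0, 1]` which are equal to `1` on `C`. -/
structure IsCutoff {Θ : Type*} [MeasurableSpace Θ] (ν : Measure Θ) (C : Set Θ) (h : Θ → ℝ) :
    Prop where
  measurable : Measurable h
  nonneg : ∀ θ, 0 ≤ h θ
  le_one : ∀ θ, h θ ≤ 1
  integrable : Integrable h ν
  eq_one : ∀ θ ∈ C, h θ = 1

variable {Θ X : Type*} [MeasurableSpace Θ] [MeasurableSpace X]

lemma IsCutoff.isTest {ν : Measure Θ} {C : Set Θ} {h : Θ → ℝ} (hh : IsCutoff ν C h) :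
    IsTest ν h :=
  ⟨hh.measurable, ⟨1, fun θ => by rw [abs_of_nonneg (hh.nonneg θ)]; exact hh.le_one θ⟩,
    hh.integrable⟩

lemma IsCutoff.mono {ν : Measure Θ} {C C' : Set Θ} {h : Θ → ℝ} (hh : IsCutoff ν C h)
    (hC : C' ⊆ C) : IsCutoff ν C' h :=
  ⟨hh.measurable, hh.nonneg, hh.le_one, hh.integrable, fun θ hθ => hh.eq_one θ (hC hθ)⟩

/-- Cutoff functions for `C` may have arbitrarily small energy. -/
def HasSmallCutoffs (P : Kernel Θ X) (ν : Measure Θ) (Q : Kernel X Θ) (C : Set Θ) : Prop :=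
  ∀ ε : ℝ, 0 < ε → ∃ h, IsCutoff ν C h ∧ dirichletForm P ν Q h h < ε

lemma HasSmallCutoffs.mono {P : Kernel Θ X} {ν : Measure Θ} {Q : Kernel X Θ} {C C' : Set Θ}
    (h : HasSmallCutoffs P ν Q C) (hC : C' ⊆ C) : HasSmallCutoffs P ν Q C' := fun ε hε =>
  let ⟨f, hf, hfε⟩ := h ε hε
  ⟨f, hf.mono hC, hfε⟩

variable {P : Kernel Θ X} [IsMarkovKernel P] {ν : Measure Θ} [SigmaFinite ν] {Q : Kernel X Θ}
  [IsMarkovKernel Q] {C : Set Θ} {R : Kernel Θ Θ}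

/-- Approximations of the probability of hitting `C`, along an exhaustion of the space by sets of
finite measure. -/
noncomputable def hitApprox (R : Kernel Θ Θ) (ν : Measure Θ) [SigmaFinite ν] (C : Set Θ) (n : ℕ)
    (θ : Θ) : ℝ :=
  (potential R C (spanningSets ν) n θ).toReal

/-- The probability of hitting `C`. -/
noncomputable def hitLimit (R : Kernel Θ Θ) (ν : Measure Θ) [SigmaFinite ν] (C : Set Θ)
    (θ : Θ) : ℝ :=
  (limitPotential R C (spanningSets ν) θ).toReal

lemma hitLimit_of_mem {θ : Θ} (hθ : θ ∈ C) : hitLimit R ν C θ = 1 := by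
  simp [hitLimit, limitPotential_of_mem hθ]

lemma measurable_integral_hitApprox (hC : MeasurableSet C) (n : ℕ) :
    Measurable fun θ => ∫ η, hitApprox R ν C n η ∂(R θ) :=
  ((measurable_potential hC (measurableSet_spanningSets ν)
    n).ennreal_toReal.stronglyMeasurable.integral_kernel).measurable

lemma measurable_integral_hitLimit (hC : MeasurableSet C) :
    Measurable fun θ => ∫ η, hitLimit R ν C η ∂(R θ) :=
  ((measurable_limitPotential hC
    (measurableSet_spanningSets ν)).ennreal_toReal.stronglyMeasurable.integral_kernel).measurable

variable [IsMarkovKernel R]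

lemma isCutoff_hitApprox (hC : MeasurableSet C) (hν : ν C < ∞) (n : ℕ) :
    IsCutoff ν C (hitApprox R ν C n) := by
  have hm := measurable_potential (R := R) hC (measurableSet_spanningSets ν) n
  refine ⟨hm.ennreal_toReal, fun _ => ENNReal.toReal_nonneg,
    fun θ => ENNReal.toReal_le_of_le_ofReal zero_le_one (by simpa using potential_le_one n θ), ?_,
    fun θ hθ => by simp [hitApprox, potential_of_mem hθ]⟩
  refine integrable_toReal_of_lintegral_ne_top hm.aemeasurable (ne_of_lt ?_)
  have hS : MeasurableSet (C ∪ spanningSets ν n) := hC.union (measurableSet_spanningSets ν n)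
  calc ∫⁻ θ, potential R C (spanningSets ν) n θ ∂ν
      ≤ ∫⁻ θ, (C ∪ spanningSets ν n).indicator 1 θ ∂ν := by
        refine lintegral_mono fun θ => ?_
        by_cases h : θ ∈ C ∪ spanningSets ν n
        · simpa [h] using potential_le_one n θ
        · rw [Set.mem_union, not_or] at h
          simp [potential_eq_zero h.1 (monotone_spanningSets ν) h.2]
    _ = ν (C ∪ spanningSets ν n) := lintegral_indicator_one hS
    _ ≤ ν C + ν (spanningSets ν n) := measure_union_le _ _
    _ < ∞ := ENNReal.add_lt_top.2 ⟨hν, measure_spanningSets_lt_top ν n⟩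

lemma limitPotential_le_one {D : ℕ → Set Θ} (θ : Θ) : limitPotential R C D θ ≤ 1 :=
  iSup_le fun n => potential_le_one n θ

lemma lintegral_le_one_of_le_one {α : Type*} [MeasurableSpace α] {μ : Measure α}
    [IsProbabilityMeasure μ] {f : α → ℝ≥0∞} (hf : ∀ x, f x ≤ 1) : ∫⁻ x, f x ∂μ ≤ 1 :=
  (lintegral_mono hf).trans (by simp)

lemma integral_hitApprox (hC : MeasurableSet C) (n : ℕ) (θ : Θ) :
    ∫ η, hitApprox R ν C n η ∂(R θ) =
      (∫⁻ η, potential R C (spanningSets ν) n η ∂(R θ)).toReal :=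
  integral_toReal (measurable_potential hC (measurableSet_spanningSets ν) n).aemeasurable
    (.of_forall fun η => (potential_le_one n η).trans_lt ENNReal.one_lt_top)

lemma integral_hitLimit (hC : MeasurableSet C) (θ : Θ) :
    ∫ η, hitLimit R ν C η ∂(R θ) =
      (∫⁻ η, limitPotential R C (spanningSets ν) η ∂(R θ)).toReal :=
  integral_toReal (measurable_limitPotential hC (measurableSet_spanningSets ν)).aemeasurable
    (.of_forall fun η => (limitPotential_le_one η).trans_lt ENNReal.one_lt_top)

lemma tendsto_hitApprox (θ : Θ) :
    Tendsto (fun n => hitApprox R ν C n θ) atTop (𝓝 (hitLimit R ν C θ)) :=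
  (ENNReal.tendsto_toReal ((limitPotential_le_one θ).trans_lt ENNReal.one_lt_top).ne).comp
    (tendsto_atTop_iSup fun _ _ h => monotone_potential (monotone_spanningSets ν) h θ)

lemma tendsto_integral_hitApprox (hC : MeasurableSet C) (θ : Θ) :
    Tendsto (fun n => ∫ η, hitApprox R ν C n η ∂(R θ)) atTop
      (𝓝 (∫ η, hitLimit R ν C η ∂(R θ))) := by
  simp_rw [integral_hitApprox hC, integral_hitLimit hC]
  refine (ENNReal.tendsto_toReal ((lintegral_le_one_of_le_one
    limitPotential_le_one).trans_lt ENNReal.one_lt_top).ne).comp ?_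
  rw [lintegral_limitPotential hC (measurableSet_spanningSets ν) (monotone_spanningSets ν)]
  exact tendsto_atTop_iSup fun _ _ h =>
    lintegral_mono (monotone_potential (monotone_spanningSets ν) h)

lemma hitLimit_of_notMem (hC : MeasurableSet C) {θ : Θ} (hθ : θ ∉ C) :
    hitLimit R ν C θ = ∫ η, hitLimit R ν C η ∂(R θ) := by
  rw [integral_hitLimit hC, hitLimit, limitPotential_of_notMem hC (measurableSet_spanningSets ν)
    (monotone_spanningSets ν) (iUnion_spanningSets ν) hθ]

lemma hitApprox_le_integral (hC : MeasurableSet C) {θ : Θ} (hθ : θ ∉ C) (n : ℕ) :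
    hitApprox R ν C n θ ≤ ∫ η, hitApprox R ν C n η ∂(R θ) := by
  rw [integral_hitApprox hC, hitApprox]
  exact ENNReal.toReal_mono ((lintegral_le_one_of_le_one
    (potential_le_one n)).trans_lt ENNReal.one_lt_top).ne
    (potential_le_lintegral (monotone_spanningSets ν) hθ n)

lemma integral_hitLimit_le_one (hC : MeasurableSet C) (θ : Θ) :
    ∫ η, hitLimit R ν C η ∂(R θ) ≤ 1 := by
  rw [integral_hitLimit hC]
  exact ENNReal.toReal_le_of_le_ofReal zero_le_one
    (by simpa using lintegral_le_one_of_le_one limitPotential_le_one)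

lemma integral_hitApprox_mem_Icc (hC : MeasurableSet C) (n : ℕ) (θ : Θ) :
    ∫ η, hitApprox R ν C n η ∂(R θ) ∈ Set.Icc (0 : ℝ) 1 := by
  rw [integral_hitApprox hC]
  exact ⟨ENNReal.toReal_nonneg, ENNReal.toReal_le_of_le_ofReal zero_le_one
    (by simpa using lintegral_le_one_of_le_one (potential_le_one n))⟩

lemma pathLaw_returnEvent_lt_one_iff_integral (hC : MeasurableSet C) (θ : Θ) :
    pathLaw R θ (returnEvent C) < 1 ↔ ∫ η, hitLimit R ν C η ∂(R θ) < 1 := by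
  rw [pathLaw_returnEvent_lt_one_iff_lintegral hC (measurableSet_spanningSets ν)
    (monotone_spanningSets ν) (iUnion_spanningSets ν), integral_hitLimit hC,
    ← ENNReal.toReal_one, ENNReal.toReal_lt_toReal (ne_top_of_le_ne_top ENNReal.one_ne_top
      (lintegral_le_one_of_le_one limitPotential_le_one)) ENNReal.one_ne_top]

lemma tendsto_integral_escape (hC : MeasurableSet C) (hν : ν C < ∞) :
    Tendsto (fun n => ∫ θ in C, (1 - ∫ η, hitApprox R ν C n η ∂(R θ)) ∂ν) atTop
      (𝓝 (∫ θ in C, (1 - ∫ η, hitLimit R ν C η ∂(R θ)) ∂ν)) := by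
  refine tendsto_integral_of_dominated_convergence (fun _ => 1) (fun n =>
    (measurable_const.sub (measurable_integral_hitApprox hC n)).aestronglyMeasurable)
    (integrableOn_const hν.ne) (fun n => .of_forall fun θ => ?_)
    (.of_forall fun θ => (tendsto_integral_hitApprox hC θ).const_sub 1)
  obtain ⟨h0, h1⟩ := integral_hitApprox_mem_Icc (R := R) (ν := ν) hC n θ
  rw [Real.norm_eq_abs, abs_le]
  constructor <;> linarith

lemma integrableOn_escape (hC : MeasurableSet C) (hν : ν C < ∞) (n : ℕ) :
    IntegrableOn (fun θ => 1 - ∫ η, hitApprox R ν C n η ∂(R θ)) C ν := by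
  have : IsFiniteMeasure (ν.restrict C) := ⟨by simpa using hν⟩
  refine integrable_of_abs_le (K := 1)
    (measurable_const.sub (measurable_integral_hitApprox hC n)) fun θ => ?_
  obtain ⟨h0, h1⟩ := integral_hitApprox_mem_Icc (R := R) (ν := ν) hC n θ
  rw [abs_le]
  constructor <;> linarith

/-- In Green's formula the truncation equals `1` on `C`, which produces the escape term; off `C` it
is nonnegative and subharmonic, so its contribution is nonpositive. -/
lemma IsFormalPosterior.dirichletForm_hitApprox_le (hQ : IsFormalPosterior P ν Q)
    (hC : MeasurableSet C) (hν : ν C < ∞) (n : ℕ) :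
    dirichletForm P ν Q (hitApprox (transition P Q) ν C n) (hitApprox (transition P Q) ν C n) ≤
      ∫ θ in C, (1 - ∫ η, hitApprox (transition P Q) ν C n η ∂(transition P Q θ)) ∂ν := by
  have hc := isCutoff_hitApprox (R := transition P Q) hC hν n
  rw [hQ.dirichletForm_eq hc.isTest hc.isTest, ← integral_indicator hC]
  refine integral_mono ?_ ((integrableOn_escape hC hν n).integrable_indicator hC) fun θ => ?_
  · refine hc.integrable.mul_bdd (c := 1) (hc.measurable.sub
      (measurable_integral_hitApprox hC n)).aestronglyMeasurable (.of_forall fun θ => ?_)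
    obtain ⟨h0, h1⟩ := integral_hitApprox_mem_Icc (R := transition P Q) (ν := ν) hC n θ
    have h2 := hc.nonneg θ
    have h3 := hc.le_one θ
    rw [Real.norm_eq_abs, abs_le]
    constructor <;> linarith
  · by_cases hθ : θ ∈ C
    · simp [hθ, hc.eq_one θ hθ]
    · simp only [hθ, not_false_eq_true, Set.indicator_of_notMem]
      exact mul_nonpos_of_nonneg_of_nonpos (hc.nonneg θ)
        (sub_nonpos.2 (hitApprox_le_integral hC hθ n))

/-- The truncated hitting probabilities are the cutoffs: their energy is bounded by the escape mass
from `C`, which tends to `0` when almost every start in `C` returns. -/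
lemma IsFormalPosterior.hasSmallCutoffs (hQ : IsFormalPosterior P ν Q)
    (hC : MeasurableSet C) (hν : ν C < ∞) (hrec : IsLocallyRecurrentSet (transition P Q) ν C) :
    HasSmallCutoffs P ν Q C := by
  have hz : ∫ θ in C, (1 - ∫ η, hitLimit (transition P Q) ν C η ∂(transition P Q θ)) ∂ν = 0 := by
    refine integral_eq_zero_of_ae ?_
    rw [Filter.EventuallyEq, ae_restrict_iff' hC]
    have : ∀ᵐ θ ∂ν, ¬ (θ ∈ C ∧ pathLaw (transition P Q) θ (returnEvent C) < 1) := by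
      simpa only [ae_iff, not_not, IsLocallyRecurrentSet] using hrec
    filter_upwards [this] with θ hθ hθC
    rw [pathLaw_returnEvent_lt_one_iff_integral (ν := ν) hC] at hθ
    have h1 := integral_hitLimit_le_one (R := transition P Q) (ν := ν) hC θ
    have h2 := not_lt.1 fun h => hθ ⟨hθC, h⟩
    simp only [Pi.zero_apply]
    linarith
  intro ε hε
  have ht := tendsto_integral_escape (R := transition P Q) hC hν
  rw [hz] at ht
  obtain ⟨n, hn⟩ := (ht.eventually_lt_const hε).exists
  exact ⟨_, isCutoff_hitApprox hC hν n, (hQ.dirichletForm_hitApprox_le hC hν n).trans_lt hn⟩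

/-- The escape mass `L` is the limit of `E(h, hₙ)`, where `h` is any cutoff and `hₙ` are the
truncations. Since `E(hₙ, hₙ) ≤ ν(C)` uniformly and `E(h, h)` is as small as desired, Cauchy-Schwarz
forces `L = 0`. -/
lemma HasSmallCutoffs.isLocallyRecurrentSet (hQ : IsFormalPosterior P ν Q)
    (hC : MeasurableSet C) (hν : ν C < ∞) (hs : HasSmallCutoffs P ν Q C) :
    IsLocallyRecurrentSet (transition P Q) ν C := by
  set R := transition P Q with hR
  set L := ∫ θ in C, (1 - ∫ η, hitLimit R ν C η ∂(R θ)) ∂ν with hL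
  have hfin : IsFiniteMeasure (ν.restrict C) := ⟨by simpa using hν⟩
  have hesc : ∀ n, ∫ θ in C, (1 - ∫ η, hitApprox R ν C n η ∂(R θ)) ∂ν ≤ ν.real C := fun n => by
    calc _ ≤ ∫ θ in C, (1 : ℝ) ∂ν := integral_mono (integrableOn_escape hC hν n)
          (integrable_const _) fun θ => by
            have := (integral_hitApprox_mem_Icc (R := R) (ν := ν) hC n θ).1
            simp only; linarith
      _ = _ := by simp
  have key : ∀ c : ℝ, 0 < c → 2 * c * L ≤ 1 + ν.real C := by
    intro c hc
    -- The energy `1 / c²` makes the term `c² E(h, h)` of Cauchy-Schwarz at most `1`, uniformly in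
    -- `c`.
    obtain ⟨h, hh, hE⟩ := hs (1 / c ^ 2) (by positivity)
    have hE' : c ^ 2 * dirichletForm P ν Q h h ≤ 1 := by
      have := mul_le_mul_of_nonneg_left hE.le (sq_nonneg c)
      rwa [mul_one_div_cancel (by positivity)] at this
    have hlim : Tendsto (fun n => dirichletForm P ν Q h (hitApprox R ν C n)) atTop (𝓝 L) := by
      -- The limit is harmonic off `C`, so only `C` contributes, where `h` and the limit are both
      -- `1`.
      have hLe : L = ∫ θ, h θ * (hitLimit R ν C θ - ∫ η, hitLimit R ν C η ∂(R θ)) ∂ν := by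
        rw [hL, ← integral_indicator hC]
        refine integral_congr_ae (.of_forall fun θ => ?_)
        by_cases hθ : θ ∈ C
        · simp [hθ, hh.eq_one θ hθ, hitLimit_of_mem hθ]
        · simp [hθ, ← hitLimit_of_notMem hC hθ]
      rw [hLe]
      have hcn := isCutoff_hitApprox (R := R) hC hν
      simp_rw [fun n => hQ.dirichletForm_eq hh.isTest (hcn n).isTest]
      refine tendsto_integral_of_dominated_convergence h (fun n => (hh.measurable.mul
        ((hcn n).measurable.sub (measurable_integral_hitApprox hC n))).aestronglyMeasurable)
        hh.integrable (fun n => .of_forall fun θ => ?_)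
        (.of_forall fun θ => ((tendsto_hitApprox θ).sub
          (tendsto_integral_hitApprox hC θ)).const_mul _)
      obtain ⟨h0, h1⟩ := integral_hitApprox_mem_Icc (R := R) (ν := ν) hC n θ
      rw [Real.norm_eq_abs, abs_mul, abs_of_nonneg (hh.nonneg θ)]
      refine mul_le_of_le_one_right (hh.nonneg θ) ?_
      have h2 := (hcn n).nonneg θ
      have h3 := (hcn n).le_one θ
      rw [abs_le]
      constructor <;> linarith
    refine le_of_tendsto (hlim.const_mul (2 * c)) (.of_forall fun n => ?_)
    have h1 := hQ.two_mul_dirichletForm_le hh.isTest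
      (isCutoff_hitApprox (R := R) hC hν n).isTest c
    have h2 := (hQ.dirichletForm_hitApprox_le hC hν n).trans (hesc n)
    linarith
  have hnn : ∀ θ, 0 ≤ 1 - ∫ η, hitLimit R ν C η ∂(R θ) := fun θ =>
    sub_nonneg.2 (integral_hitLimit_le_one hC θ)
  have hL0 : L = 0 := by
    refine le_antisymm (not_lt.1 fun hpos => ?_) (integral_nonneg hnn)
    have h0 : 0 ≤ ν.real C := measureReal_nonneg
    -- With this `c` the bound reads `2 (1 + ν(C)) ≤ 1 + ν(C)`.
    have := key ((1 + ν.real C) / L) (by positivity)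
    rw [mul_assoc, div_mul_cancel₀ _ hpos.ne'] at this
    linarith
  rw [hL, integral_eq_zero_iff_of_nonneg hnn] at hL0
  · rw [Filter.EventuallyEq, ae_restrict_iff' hC, ae_iff] at hL0
    refine measure_mono_null (fun θ hθ => ?_) hL0
    have hlt := (pathLaw_returnEvent_lt_one_iff_integral (ν := ν) hC θ).1 hθ.2
    simp only [Pi.zero_apply, Set.mem_ofPred_eq, Classical.not_imp]
    exact ⟨hθ.1, by linarith⟩
  · refine integrable_of_abs_le (K := 1)
      (measurable_const.sub (measurable_integral_hitLimit hC)) fun θ => ?_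
    have h0 : 0 ≤ ∫ η, hitLimit R ν C η ∂(R θ) := integral_nonneg fun _ => ENNReal.toReal_nonneg
    have h1 := hnn θ
    rw [abs_le]
    constructor <;> linarith

end Recurrence

/-! ### Existence of disintegrations and formal posteriors. -/

section Disintegration

/-- A measure on a product, with `σ`-finite first marginal, disintegrates over this marginal. -/
lemma exists_isMarkovKernel_fst_compProd_eq {α Ω : Type*} [MeasurableSpace α] [MeasurableSpace Ω]
    [StandardBorelSpace Ω] [Nonempty Ω] (ρ : Measure (α × Ω)) [SigmaFinite ρ.fst] :
    ∃ κ : Kernel α Ω, IsMarkovKernel κ ∧ ρ.fst ⊗ₘ κ = ρ := by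
  -- A positive density in the first coordinate makes the measure finite and leaves the conditional
  -- laws of the second unchanged, so the conditional kernel of the reweighted measure also serves
  -- `ρ`.
  obtain ⟨f, hf0, hf, hf1⟩ := exists_pos_lintegral_lt_of_sigmaFinite ρ.fst one_ne_zero
  have hf' : Measurable fun a => (f a : ℝ≥0∞) := hf.coe_nnreal_ennreal
  have hfp : Measurable fun p : α × Ω => (f p.1 : ℝ≥0∞) := hf'.comp measurable_fst
  set ρ' := ρ.withDensity fun p => f p.1 with hρ'
  have hfst : ∀ g : α → ℝ≥0∞, Measurable g →
      ∫⁻ a, g a ∂ρ'.fst = ∫⁻ a, f a * g a ∂ρ.fst := by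
    intro g hg
    rw [Measure.fst, lintegral_map hg measurable_fst, Measure.fst,
      lintegral_map (f := fun a => f a * g a) (hf'.mul hg) measurable_fst, hρ',
      lintegral_withDensity_eq_lintegral_mul _ hfp (g := fun p => g p.1) (hg.comp measurable_fst)]
    rfl
  have hfin : IsFiniteMeasure ρ' := by
    refine isFiniteMeasure_withDensity (ne_of_lt ?_)
    rw [Measure.fst, lintegral_map hf' measurable_fst] at hf1
    exact hf1.trans ENNReal.one_lt_top
  refine ⟨ρ'.condKernel, inferInstance, ?_⟩
  ext s hs
  have hinv : ∀ a, (f a : ℝ≥0∞) * (f a : ℝ≥0∞)⁻¹ = 1 := fun a =>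
    ENNReal.mul_inv_cancel (by simpa using (hf0 a).ne') ENNReal.coe_ne_top
  have hsm : Measurable (s.indicator (1 : α × Ω → ℝ≥0∞)) := measurable_one.indicator hs
  have hG : Measurable fun p : α × Ω => (f p.1 : ℝ≥0∞)⁻¹ * s.indicator 1 p := hfp.inv.mul hsm
  have hκ : Measurable fun a => ∫⁻ b, s.indicator 1 (a, b) ∂(ρ'.condKernel a) :=
    hsm.lintegral_kernel_prod_right'
  have h1 : ∫⁻ p, (f p.1 : ℝ≥0∞)⁻¹ * s.indicator 1 p ∂ρ' = ρ s := by
    rw [hρ', lintegral_withDensity_eq_lintegral_mul _ hfp hG, ← lintegral_indicator_one hs]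
    refine lintegral_congr fun p => ?_
    rw [Pi.mul_apply, ← mul_assoc, hinv, one_mul]
  have h2 := Measure.lintegral_compProd (μ := ρ'.fst) (κ := ρ'.condKernel) hG
  rw [ρ'.disintegrate ρ'.condKernel] at h2
  rw [← h1, h2, ← lintegral_indicator_one hs, Measure.lintegral_compProd hsm]
  have h3 : ∀ a, ∫⁻ b, (f a : ℝ≥0∞)⁻¹ * s.indicator 1 (a, b) ∂(ρ'.condKernel a) =
      (f a : ℝ≥0∞)⁻¹ * ∫⁻ b, s.indicator 1 (a, b) ∂(ρ'.condKernel a) := fun a =>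
    lintegral_const_mul _ (hsm.comp measurable_prodMk_left)
  simp_rw [h3]
  rw [hfst (fun a => (f a : ℝ≥0∞)⁻¹ * ∫⁻ b, s.indicator 1 (a, b) ∂(ρ'.condKernel a))
    (hf'.inv.mul hκ)]
  refine lintegral_congr fun a => ?_
  rw [← mul_assoc, hinv, one_mul]

lemma exists_isFormalPosterior {Θ X : Type*} [MeasurableSpace Θ] [MeasurableSpace X]
    [StandardBorelSpace Θ] [Nonempty Θ] (P : Kernel Θ X) [IsMarkovKernel P] (ν : Measure Θ)
    [SFinite ν] (hM : SigmaFinite (P ∘ₘ ν)) :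
    ∃ Q : Kernel X Θ, IsMarkovKernel Q ∧ IsFormalPosterior P ν Q := by
  have hfst : ((ν ⊗ₘ P).map Prod.swap).fst = P ∘ₘ ν := by
    rw [Measure.fst_map_swap, Measure.snd_compProd]
  have : SigmaFinite ((ν ⊗ₘ P).map Prod.swap).fst := by rwa [hfst]
  obtain ⟨Q, hQ, h⟩ := exists_isMarkovKernel_fst_compProd_eq ((ν ⊗ₘ P).map Prod.swap)
  refine ⟨Q, hQ, ?_⟩
  rw [IsFormalPosterior, ← hfst, h, Measure.map_map measurable_swap measurable_swap]
  simp

variable {Θ : Type*} [MeasurableSpace Θ] {ν : Measure Θ} {t : Θ → ℝ≥0}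

/-- Disintegrate the image of `ν` on the graph of `t` over its first marginal. -/
lemma exists_disintegrates [StandardBorelSpace Θ] [Nonempty Θ] (ht : Measurable t)
    [SigmaFinite (ν.map t)] : ∃ π : Kernel ℝ≥0 Θ, IsMarkovKernel π ∧ Disintegrates ν t π := by
  have hm : Measurable fun θ => (t θ, θ) := ht.prodMk measurable_id
  have hfst : (ν.map fun θ => (t θ, θ)).fst = ν.map t := Measure.fst_map_prodMk measurable_id
  have : SigmaFinite (ν.map fun θ => (t θ, θ)).fst := by rwa [hfst]
  obtain ⟨π, hπ, h⟩ := exists_isMarkovKernel_fst_compProd_eq (ν.map fun θ => (t θ, θ))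
  rw [hfst] at h
  refine ⟨π, hπ, fun f₁ f₂ h₁ h₂ => ?_⟩
  have hF : Measurable fun p : ℝ≥0 × Θ => f₂ p.1 * f₁ p.2 := by fun_prop
  have h' := Measure.lintegral_compProd (μ := ν.map t) (κ := π) hF
  rw [h, lintegral_map hF hm] at h'
  simpa only [lintegral_const_mul _ h₁] using h'

lemma IsProperPartition.sigmaFinite_map {A : ℕ → Set ℝ≥0} (hA : IsProperPartition ν t A)
    (ht : Measurable t) : SigmaFinite (ν.map t) :=
  ⟨⟨{ set := A
      set_mem := fun _ => trivial
      finite := fun i => by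
        rw [Measure.map_apply ht (hA.1 i)]
        exact (hA.2.2.2 i).2.2
      spanning := hA.2.2.1 }⟩⟩

lemma IsProperPartition.isProper_map {A : ℕ → Set ℝ≥0} (hA : IsProperPartition ν t A)
    (ht : Measurable t) (i : ℕ) : IsProper (ν.map t) (A i) := by
  rw [IsProper, Measure.map_apply ht (hA.1 i)]
  exact ⟨hA.1 i, (hA.2.2.2 i).2⟩

lemma Disintegrates.comp_eq {π : Kernel ℝ≥0 Θ} (hπ : Disintegrates ν t π) :
    π ∘ₘ (ν.map t) = ν := by
  ext s hs
  rw [Measure.bind_apply hs (by fun_prop)]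
  have h := hπ (s.indicator 1) 1 (measurable_one.indicator hs) measurable_one
  simpa [lintegral_indicator_one hs] using h.symm

lemma Disintegrates.reducedModel_comp_eq {X : Type*} [MeasurableSpace X] {π : Kernel ℝ≥0 Θ}
    (hπ : Disintegrates ν t π) (P : Kernel Θ X) : reducedModel P π ∘ₘ (ν.map t) = P ∘ₘ ν := by
  rw [reducedModel, ← Measure.comp_assoc, hπ.comp_eq]

end Disintegration

/-! ### Transfer of cutoffs from the reduced model to the full model. -/

section Lifting

variable {Θ X : Type*} [MeasurableSpace Θ] [MeasurableSpace X] {P : Kernel Θ X} [IsMarkovKernel P]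
  {ν : Measure Θ} [SFinite ν] {t : Θ → ℝ≥0} {π : Kernel ℝ≥0 Θ} [IsMarkovKernel π]
  {Q : Kernel X Θ} [IsMarkovKernel Q] {Qr : Kernel X ℝ≥0} [IsMarkovKernel Qr]

/-- The image of `Q` under `t` and `Qr` both disintegrate the joint measure of `(t θ, x)` over the
same marginal `M`; comparing integrals over sets of `x` gives equality almost everywhere. -/
lemma lintegral_posterior_comp_ae_eq [SigmaFinite (P ∘ₘ ν)] (ht : Measurable t)
    (hπ : Disintegrates ν t π) (hQ : IsFormalPosterior P ν Q)
    (hQr : IsFormalPosterior (reducedModel P π) (ν.map t) Qr) {g : ℝ≥0 → ℝ≥0∞}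
    (hg : Measurable g) :
    (fun x => ∫⁻ θ, g (t θ) ∂(Q x)) =ᵐ[P ∘ₘ ν] fun x => ∫⁻ a, g a ∂(Qr x) := by
  have hgt : Measurable fun θ => g (t θ) := hg.comp ht
  refine ae_eq_of_forall_setLIntegral_eq_of_sigmaFinite hgt.lintegral_kernel hg.lintegral_kernel
    fun s hs _ => ?_
  have hs1 : Measurable (s.indicator (1 : X → ℝ≥0∞)) := measurable_one.indicator hs
  have h1 := hQ.lintegral_swap (F := fun p => s.indicator 1 p.2 * g (t p.1)) (by fun_prop)
  have h2 := hQr.lintegral_swap (F := fun p => s.indicator 1 p.2 * g p.1) (by fun_prop)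
  simp only [lintegral_const_mul _ hgt, lintegral_const_mul _ hg, lintegral_mul_const _ hs1,
    lintegral_indicator_one hs] at h1 h2
  rw [hπ.reducedModel_comp_eq] at h2
  have e : ∀ u : X → ℝ≥0∞, ∫⁻ x in s, u x ∂(P ∘ₘ ν) =
      ∫⁻ x, s.indicator 1 x * u x ∂(P ∘ₘ ν) := fun u => by
    rw [← lintegral_indicator hs]
    refine lintegral_congr fun x => ?_
    by_cases hx : x ∈ s <;> simp [hx]
  rw [e, e, ← h1, ← h2]
  simp_rw [mul_comm _ (g _)]
  rw [hπ (fun θ => P θ s) g (P.measurable_coe hs) hg]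
  refine lintegral_congr fun a => ?_
  rw [reducedModel, Kernel.comp_apply' _ _ _ hs]

lemma bayesEstimator_comp_ae_eq [SigmaFinite (P ∘ₘ ν)] (ht : Measurable t)
    (hπ : Disintegrates ν t π) (hQ : IsFormalPosterior P ν Q)
    (hQr : IsFormalPosterior (reducedModel P π) (ν.map t) Qr) {g : ℝ≥0 → ℝ}
    (hg : Measurable g) (hg0 : ∀ a, 0 ≤ g a) :
    bayesEstimator Q (fun θ => g (t θ)) =ᵐ[P ∘ₘ ν] bayesEstimator Qr g := by
  filter_upwards [lintegral_posterior_comp_ae_eq ht hπ hQ hQr hg.ennreal_ofReal] with x hx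
  rw [bayesEstimator, bayesEstimator, integral_eq_lintegral_of_nonneg_ae
    (.of_forall fun θ => hg0 (t θ)) (hg.comp ht).aestronglyMeasurable, hx,
    ← integral_eq_lintegral_of_nonneg_ae (.of_forall hg0) hg.aestronglyMeasurable]

/-- Composition with `t` preserves the energy exactly: the `L²` term by change of variables, the
posterior term because the posterior means agree `M`-almost everywhere. -/
lemma HasSmallCutoffs.preimage [SigmaFinite (P ∘ₘ ν)] (ht : Measurable t)
    (hπ : Disintegrates ν t π) (hQ : IsFormalPosterior P ν Q)
    (hQr : IsFormalPosterior (reducedModel P π) (ν.map t) Qr) {A : Set ℝ≥0}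
    (hA : HasSmallCutoffs (reducedModel P π) (ν.map t) Qr A) :
    HasSmallCutoffs P ν Q (t ⁻¹' A) := by
  intro ε hε
  obtain ⟨g, hg, hE⟩ := hA ε hε
  refine ⟨fun θ => g (t θ), ⟨hg.measurable.comp ht, fun θ => hg.nonneg _, fun θ => hg.le_one _,
    hg.integrable.comp_measurable ht, fun θ hθ => hg.eq_one _ hθ⟩, lt_of_eq_of_lt ?_ hE⟩
  have hae := bayesEstimator_comp_ae_eq ht hπ hQ hQr hg.measurable hg.nonneg
  have hgg : Measurable fun a => g a * g a := hg.measurable.mul hg.measurable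
  rw [dirichletForm, dirichletForm, hπ.reducedModel_comp_eq, integral_map ht.aemeasurable
    hgg.aestronglyMeasurable]
  congr 1
  refine integral_congr_ae ?_
  filter_upwards [hae] with x hx
  rw [hx]

end Lifting

/-! ### Blyth's method with cutoffs of small energy. -/

section Admissibility

/-- The pointwise estimate behind Blyth's method: weighting by the square of a function `h` with
values in `[0, 1]`, the mean of `φ` loses at most a multiple of the variance of `h` against any
other constant `d`. -/
lemma lintegral_weighted_sq_le {Θ : Type*} [MeasurableSpace Θ] {q : Measure Θ}
    [IsProbabilityMeasure q] {φ h : Θ → ℝ} (hφ : Measurable φ) {K : ℝ} (hK : ∀ θ, |φ θ| ≤ K)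
    (hh : Measurable h) (h0 : ∀ θ, 0 ≤ h θ) (h1 : ∀ θ, h θ ≤ 1) (d : ℝ) :
    ∫⁻ θ, ENNReal.ofReal (h θ ^ 2 * (∫ η, φ η ∂q - φ θ) ^ 2) ∂q ≤
      ∫⁻ θ, ENNReal.ofReal (h θ ^ 2 * (d - φ θ) ^ 2) ∂q +
        ENNReal.ofReal (16 * K ^ 2 * Var[h; q]) := by
  have hsq : ∀ θ, h θ ^ 2 ≤ 1 := fun θ => pow_le_one₀ (h0 θ) (h1 θ)
  have hi : ∀ c : ℝ, Integrable (fun θ => h θ ^ 2 * (c - φ θ) ^ 2) q := fun c => by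
    refine integrable_of_abs_le (K := (|c| + K) ^ 2) (by fun_prop) fun θ => ?_
    rw [abs_of_nonneg (by positivity)]
    have h2 : (c - φ θ) ^ 2 ≤ (|c| + K) ^ 2 := by
      rw [← sq_abs (c - φ θ)]
      have := (abs_sub c (φ θ)).trans (add_le_add le_rfl (hK θ))
      gcongr
    exact (mul_le_of_le_one_left (sq_nonneg _) (hsq θ)).trans h2
  have ih : Integrable h q := integrable_of_abs_le (K := 1) hh fun θ => by
    rw [abs_of_nonneg (h0 θ)]; exact h1 θ
  have ih2 : Integrable (fun θ => h θ ^ 2) q := integrable_of_abs_le (K := 1) (by fun_prop)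
    fun θ => by rw [abs_of_nonneg (sq_nonneg _)]; exact hsq θ
  have iφ : Integrable φ q := integrable_of_abs_le hφ hK
  set p := ∫ η, φ η ∂q with hp
  set m := ∫ η, h η ∂q with hm
  set B := ∫ η, h η ^ 2 ∂q with hB
  have hpK : |p| ≤ K := abs_integral_le_of_abs_le hK
  have hV : Var[h; q] = B - m ^ 2 := by
    rw [variance_eq_sub (MemLp.of_bound hh.aestronglyMeasurable 1 (.of_forall fun θ => by
      rw [Real.norm_eq_abs, abs_of_nonneg (h0 θ)]; exact h1 θ))]
    rfl
  have hVnn : 0 ≤ Var[h; q] := variance_nonneg _ _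
  set e := p - d with he
  -- With `u = p - φ`, the integrand difference is `h² (2eu - e²)`. Split `2eh²u = 2em²u + 2e(h² -
  -- m²)u` and bound the last term by `e²(h + m)²/4 + 4(h - m)²u²`, where `u² ≤ 4K²`. The
  -- coefficients `a`, `b`, `c`, `k` of `h²`, `h`, `1`, `φ` collect the result. On integration the
  -- term in `u` vanishes and the `e²` terms sum to `-(3/4) e² Var h ≤ 0`.
  let a := 16 * K ^ 2 - 3 / 4 * e ^ 2
  let b := e ^ 2 * m / 2 - 32 * K ^ 2 * m
  let c := 2 * e * m ^ 2 * p + e ^ 2 * m ^ 2 / 4 + 16 * K ^ 2 * m ^ 2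
  let k := -(2 * e * m ^ 2)
  have j1 : Integrable (fun θ => a * h θ ^ 2 + b * h θ) q :=
    (ih2.const_mul a).add (ih.const_mul b)
  have j2 : Integrable (fun θ => c + k * φ θ) q := (integrable_const c).add (iφ.const_mul k)
  have hcomb : ∫ θ, ((a * h θ ^ 2 + b * h θ) + (c + k * φ θ)) ∂q = a * B + b * m + (c + k * p) := by
    rw [integral_add j1 j2, integral_add (ih2.const_mul a) (ih.const_mul b),
      integral_add (integrable_const c) (iφ.const_mul k), integral_const_mul, integral_const_mul,
      integral_const_mul]
    simp [hm, hp, hB]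
  have hle : ∫ θ, (h θ ^ 2 * (p - φ θ) ^ 2 - h θ ^ 2 * (d - φ θ) ^ 2) ∂q ≤
      ∫ θ, ((a * h θ ^ 2 + b * h θ) + (c + k * φ θ)) ∂q := by
    refine integral_mono ((hi p).sub (hi d)) (j1.add j2) fun θ => ?_
    have hb : (p - φ θ) ^ 2 ≤ 4 * K ^ 2 := by
      have := abs_le.1 (hK θ)
      have := abs_le.1 hpK
      nlinarith
    have hu : (h θ - m) ^ 2 * (p - φ θ) ^ 2 ≤ (h θ - m) ^ 2 * (4 * K ^ 2) :=
      mul_le_mul_of_nonneg_left hb (sq_nonneg _)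
    have hs := sq_nonneg (e * (h θ + m) / 2 - 2 * ((h θ - m) * (p - φ θ)))
    have hd : d = p - e := by rw [he]; ring
    simp only [a, b, c, k, hd]
    nlinarith
  rw [hcomb, integral_sub (hi p) (hi d)] at hle
  have hfin : ∫ θ, h θ ^ 2 * (p - φ θ) ^ 2 ∂q ≤
      ∫ θ, h θ ^ 2 * (d - φ θ) ^ 2 ∂q + 16 * K ^ 2 * Var[h; q] := by
    have : e ^ 2 * (B - m ^ 2) ≥ 0 := mul_nonneg (sq_nonneg _) (hV ▸ hVnn)
    rw [hV]
    simp only [a, b, c, k] at hle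
    nlinarith
  rw [← ofReal_integral_eq_lintegral_ofReal (hi p) (.of_forall fun θ => by positivity),
    ← ofReal_integral_eq_lintegral_ofReal (hi d) (.of_forall fun θ => by positivity),
    ← ENNReal.ofReal_add (integral_nonneg fun θ => by positivity) (by positivity)]
  exact ENNReal.ofReal_le_ofReal hfin

lemma ofReal_sq_mul_risk {Θ X : Type*} [MeasurableSpace Θ] [MeasurableSpace X] {P : Kernel Θ X}
    {φ : Θ → ℝ} {δ : X → ℝ} (hδ : Measurable δ) (h : Θ → ℝ) (θ : Θ) :
    ENNReal.ofReal (h θ ^ 2) * risk P φ δ θ =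
      ∫⁻ x, ENNReal.ofReal (h θ ^ 2 * (δ x - φ θ) ^ 2) ∂(P θ) := by
  rw [risk, ← lintegral_const_mul _ (by fun_prop)]
  simp_rw [ENNReal.ofReal_mul (sq_nonneg (h θ))]

variable {Θ X : Type*} [MeasurableSpace Θ] [MeasurableSpace X] {P : Kernel Θ X} [IsMarkovKernel P]
  {ν : Measure Θ} {Q : Kernel X Θ} [IsMarkovKernel Q]

lemma measurable_risk {φ : Θ → ℝ} (hφ : Measurable φ) {δ : X → ℝ} (hδ : Measurable δ) :
    Measurable (risk P φ δ) := by
  have h : Measurable fun p : Θ × X => ENNReal.ofReal ((δ p.2 - φ p.1) ^ 2) := by fun_prop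
  exact h.lintegral_kernel_prod_right'

lemma risk_bayesEstimator_le {φ : Θ → ℝ} {K : ℝ} (hK : ∀ θ, |φ θ| ≤ K) (θ : Θ) :
    risk P φ (bayesEstimator Q φ) θ ≤ ENNReal.ofReal (4 * K ^ 2) := by
  calc _ ≤ ∫⁻ _, ENNReal.ofReal (4 * K ^ 2) ∂(P θ) := by
        refine lintegral_mono fun x => ENNReal.ofReal_le_ofReal ?_
        have h1 := abs_le.1 (hK θ)
        have h2 : |bayesEstimator Q φ x| ≤ K := abs_integral_le_of_abs_le hK
        have h3 := abs_le.1 h2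
        nlinarith
    _ = _ := by simp

/-- Bayes' identity writes both weighted risks as integrals over `x` of posterior expected losses,
so the pointwise estimate applies with `d = δ x`; the variances integrate to the energy. -/
lemma IsFormalPosterior.lintegral_risk_bayesEstimator_le [SFinite ν] (hQ : IsFormalPosterior P ν Q)
    {φ : Θ → ℝ} (hφ : Measurable φ) {K : ℝ} (hK : ∀ θ, |φ θ| ≤ K) {δ : X → ℝ} (hδ : Measurable δ)
    {C : Set Θ} {h : Θ → ℝ} (hh : IsCutoff ν C h) :
    ∫⁻ θ, ENNReal.ofReal (h θ ^ 2) * risk P φ (bayesEstimator Q φ) θ ∂ν ≤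
      ∫⁻ θ, ENNReal.ofReal (h θ ^ 2) * risk P φ δ θ ∂ν +
        ENNReal.ofReal (16 * K ^ 2 * dirichletForm P ν Q h h) := by
  have hhm := hh.measurable
  have hb : Measurable (bayesEstimator Q φ) := measurable_bayesEstimator hφ
  have hV := hQ.integrable_variance hh.isTest
  simp_rw [ofReal_sq_mul_risk hδ, ofReal_sq_mul_risk hb]
  rw [hQ.lintegral_swap (F := fun p => ENNReal.ofReal (h p.1 ^ 2 * (δ p.2 - φ p.1) ^ 2))
      (by fun_prop),
    hQ.lintegral_swap (F := fun p => ENNReal.ofReal (h p.1 ^ 2 *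
      (bayesEstimator Q φ p.2 - φ p.1) ^ 2)) (by fun_prop), hQ.dirichletForm_self hh.isTest,
    ← integral_const_mul, ofReal_integral_eq_lintegral_ofReal (hV.const_mul _)
      (.of_forall fun x => mul_nonneg (by positivity) (variance_nonneg _ _)),
    ← lintegral_add_right' _ (hV.const_mul _).aestronglyMeasurable.aemeasurable.ennreal_ofReal]
  exact lintegral_mono fun x =>
    lintegral_weighted_sq_le hφ hK hhm hh.nonneg hh.le_one (δ x)

lemma HasSmallCutoffs.measure_risk_lt_eq_zero [SFinite ν] (hQ : IsFormalPosterior P ν Q)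
    {C : Set Θ} (hC : MeasurableSet C) (hs : HasSmallCutoffs P ν Q C)
    {φ : Θ → ℝ} (hφ : Measurable φ) {K : ℝ} (hK : ∀ θ, |φ θ| ≤ K) {δ : X → ℝ} (hδ : Measurable δ)
    (hle : ∀ θ, risk P φ δ θ ≤ risk P φ (bayesEstimator Q φ) θ) :
    ν {θ | θ ∈ C ∧ risk P φ δ θ < risk P φ (bayesEstimator Q φ) θ} = 0 := by
  have hb : Measurable (bayesEstimator Q φ) := measurable_bayesEstimator hφ
  have hm1 : Measurable (risk P φ δ) := measurable_risk hφ hδ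
  have hm2 : Measurable (risk P φ (bayesEstimator Q φ)) := measurable_risk hφ hb
  set D := fun θ => risk P φ (bayesEstimator Q φ) θ - risk P φ δ θ with hD
  have hbound : ∀ ε : ℝ, 0 < ε → ∫⁻ θ in C, D θ ∂ν ≤ ENNReal.ofReal (16 * K ^ 2 * ε) := by
    intro ε hε
    obtain ⟨h, hh, hE⟩ := hs ε hε
    have hhm := hh.measurable
    have hkey := hQ.lintegral_risk_bayesEstimator_le hφ hK hδ hh
    -- Finiteness is needed to subtract the weighted risks. It holds since `h² ≤ h` is integrable
    -- and `δ`, dominating the Bayes estimator, has risk at most `4K²`.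
    have hfin : ∫⁻ θ, ENNReal.ofReal (h θ ^ 2) * risk P φ δ θ ∂ν ≠ ∞ := by
      refine ne_of_lt ?_
      calc _ ≤ ∫⁻ θ, ENNReal.ofReal (h θ) * ENNReal.ofReal (4 * K ^ 2) ∂ν := by
            refine lintegral_mono fun θ => mul_le_mul' (ENNReal.ofReal_le_ofReal ?_)
              ((hle θ).trans (risk_bayesEstimator_le hK θ))
            rw [sq]
            exact mul_le_of_le_one_left (hh.nonneg θ) (hh.le_one θ)
        _ = (∫⁻ θ, ENNReal.ofReal (h θ) ∂ν) * ENNReal.ofReal (4 * K ^ 2) :=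
            lintegral_mul_const _ (by fun_prop)
        _ < ∞ := ENNReal.mul_lt_top hh.integrable.lintegral_lt_top ENNReal.ofReal_lt_top
    calc ∫⁻ θ in C, D θ ∂ν = ∫⁻ θ, C.indicator D θ ∂ν := (lintegral_indicator hC _).symm
      _ ≤ ∫⁻ θ, (ENNReal.ofReal (h θ ^ 2) * risk P φ (bayesEstimator Q φ) θ -
            ENNReal.ofReal (h θ ^ 2) * risk P φ δ θ) ∂ν := by
          refine lintegral_mono fun θ => ?_
          by_cases hθ : θ ∈ C
          · simp [hθ, hh.eq_one θ hθ, D]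
          · simp [hθ]
      _ = ∫⁻ θ, ENNReal.ofReal (h θ ^ 2) * risk P φ (bayesEstimator Q φ) θ ∂ν -
            ∫⁻ θ, ENNReal.ofReal (h θ ^ 2) * risk P φ δ θ ∂ν :=
          lintegral_sub (by fun_prop) hfin (.of_forall fun θ => mul_le_mul' le_rfl (hle θ))
      _ ≤ ENNReal.ofReal (16 * K ^ 2 * dirichletForm P ν Q h h) :=
          tsub_le_iff_left.2 hkey
      _ ≤ _ := ENNReal.ofReal_le_ofReal (mul_le_mul_of_nonneg_left hE.le (by positivity))
  have hzero : ∫⁻ θ in C, D θ ∂ν = 0 := by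
    refine le_antisymm (ENNReal.le_of_forall_pos_le_add fun ε hε _ => ?_) zero_le
    have hpos : (0 : ℝ) < ε / (16 * K ^ 2 + 1) := div_pos hε (by positivity)
    refine (hbound _ hpos).trans ?_
    rw [zero_add, ← ENNReal.ofReal_coe_nnreal]
    refine ENNReal.ofReal_le_ofReal ?_
    rw [← mul_div_assoc, div_le_iff₀ (by positivity)]
    have : (0 : ℝ) ≤ ε := ε.2
    nlinarith
  rw [lintegral_eq_zero_iff (f := D) (hm2.sub hm1), Filter.EventuallyEq, ae_restrict_iff' hC,
    ae_iff] at hzero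
  refine measure_mono_null (fun θ hθ => ?_) hzero
  simp only [Set.mem_ofPred_eq, Classical.not_imp, Pi.zero_apply]
  exact ⟨hθ.1, (tsub_pos_of_lt hθ.2).ne'⟩

end Admissibility

/-! ### From a countable cover to the whole space. -/

section Main

variable {Θ X : Type*} [MeasurableSpace Θ] [MeasurableSpace X] {P : Kernel Θ X} [IsMarkovKernel P]
  {ν : Measure Θ} {Q : Kernel X Θ} [IsMarkovKernel Q]

/-- A chain is locally recurrent if the space is covered by countably many sets of finite measure
which admit cutoff functions of arbitrarily small energy. -/
lemma IsFormalPosterior.isLocallyRecurrent [SigmaFinite ν] (hQ : IsFormalPosterior P ν Q)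
    {T : ℕ → Set Θ} (hT : ∀ i, MeasurableSet (T i)) (hU : ⋃ i, T i = Set.univ)
    (hs : ∀ i, HasSmallCutoffs P ν Q (T i)) : IsLocallyRecurrent (transition P Q) ν := by
  rintro C ⟨hC, -, hν⟩
  -- Cutoffs restrict to subsets, and the criterion asks only for finite measure, so `C ∩ T i` may
  -- be null. Returning to `C ∩ T i` is in particular returning to `C`.
  have h : ∀ i, IsLocallyRecurrentSet (transition P Q) ν (C ∩ T i) := fun i =>
    ((hs i).mono Set.inter_subset_right).isLocallyRecurrentSet hQ (hC.inter (hT i))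
      ((measure_mono Set.inter_subset_left).trans_lt hν)
  refine measure_mono_null (fun θ hθ => ?_) (measure_iUnion_null h)
  obtain ⟨i, hi⟩ := Set.mem_iUnion.1 (hU.symm.subset (Set.mem_univ θ))
  have hsub : returnEvent (C ∩ T i) ⊆ returnEvent C := fun w hw => by
    have hle : returnTime C w ≤ returnTime (C ∩ T i) w :=
      le_iInf₂ fun n hn => iInf₂_le n ⟨hn.1, hn.2.1⟩
    exact hle.trans_lt hw
  exact Set.mem_iUnion.2 ⟨i, ⟨hθ.1, hi⟩, (measure_mono hsub).trans_lt hθ.2⟩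

/-- A formal posterior is strongly admissible if the space is covered by countably many sets which
admit cutoff functions of arbitrarily small energy. -/
lemma IsFormalPosterior.isStronglyAdmissible [SFinite ν] (hQ : IsFormalPosterior P ν Q)
    {T : ℕ → Set Θ} (hT : ∀ i, MeasurableSet (T i)) (hU : ⋃ i, T i = Set.univ)
    (hs : ∀ i, HasSmallCutoffs P ν Q (T i)) : IsStronglyAdmissible P ν Q := by
  rintro φ hφ ⟨K, hK⟩ δ hδ hle
  refine measure_mono_null (fun θ hθ => ?_) (measure_iUnion_null fun i =>
    (hs i).measure_risk_lt_eq_zero hQ (hT i) hφ hK hδ hle)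
  obtain ⟨i, hi⟩ := Set.mem_iUnion.1 (hU.symm.subset (Set.mem_univ θ))
  exact Set.mem_iUnion.2 ⟨i, hi, hθ⟩

end Main

end FormalBayes

open FormalBayes
theorem theorem3p4 {Θ X : Type*}
    [TopologicalSpace Θ] [PolishSpace Θ] [MeasurableSpace Θ] [BorelSpace Θ]
    [TopologicalSpace X] [PolishSpace X] [MeasurableSpace X] [BorelSpace X]
    (P : Kernel Θ X) [IsMarkovKernel P]
    (ν : Measure Θ) [SigmaFinite ν] (hM : SigmaFinite (P ∘ₘ ν))
    (t : Θ → ℝ≥0) (ht : Measurable t)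
    (hA : ∃ A : ℕ → Set ℝ≥0, IsProperPartition ν t A) :
    (∃ π : Kernel ℝ≥0 Θ, IsMarkovKernel π ∧ Disintegrates ν t π) ∧
    (∃ Q : Kernel X Θ, IsMarkovKernel Q ∧ IsFormalPosterior P ν Q) ∧
    ∀ (π : Kernel ℝ≥0 Θ) [IsMarkovKernel π], Disintegrates ν t π →
      (∃ Qr : Kernel X ℝ≥0, IsMarkovKernel Qr ∧
        IsFormalPosterior (reducedModel P π) (ν.map t) Qr) ∧
      ∀ (Q : Kernel X Θ) [IsMarkovKernel Q] (Qr : Kernel X ℝ≥0) [IsMarkovKernel Qr],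
        IsFormalPosterior P ν Q →
        IsFormalPosterior (reducedModel P π) (ν.map t) Qr →
        IsLocallyRecurrent (transition (reducedModel P π) Qr) (ν.map t) →
        IsLocallyRecurrent (transition P Q) ν ∧ IsStronglyAdmissible P ν Q := by
  obtain ⟨A, hA⟩ := hA
  have hσ : SigmaFinite (ν.map t) := hA.sigmaFinite_map ht
  have hne : Nonempty Θ := by
    obtain ⟨θ, -⟩ := nonempty_of_measure_ne_zero (hA.2.2.2 0).2.1.ne'
    exact ⟨θ⟩
  refine ⟨exists_disintegrates ht, exists_isFormalPosterior P ν hM, fun π _ hπ =>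
    ⟨exists_isFormalPosterior _ _ (by rwa [hπ.reducedModel_comp_eq]), ?_⟩⟩
  intro Q _ Qr _ hQ hQr hrec
  -- Recurrence of the reduced chain enters only through the sets `A i`.
  have hs : ∀ i, HasSmallCutoffs P ν Q (t ⁻¹' A i) := fun i => by
    have hp := hA.isProper_map ht i
    exact (hQr.hasSmallCutoffs hp.1 hp.2.2 (hrec _ hp)).preimage ht hπ hQ hQr
  have hT : ∀ i, MeasurableSet (t ⁻¹' A i) := fun i => ht (hA.1 i)
  have hU : ⋃ i, t ⁻¹' A i = Set.univ := by
    rw [← Set.preimage_iUnion, hA.2.2.1, Set.preimage_univ]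
  exact ⟨hQ.isLocallyRecurrent hT hU hs, hQ.isStronglyAdmissible hT hU hs⟩
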